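/- **Setting.** Index the variables by $j\in\mathbb N$, let $\mathbb F$ be the set of finitely supported sequences $s=(s_j)_{j\in\mathbb N}$ of non-negative integers, let $a,b>-1$, $0<q<\infty$, and let $\nu_{a,b}=\bigotimes_{j\in\mathbb N} c_{a,b}(1-y_j)^a(1+y_j)^b\,dy_j$ with $c_{a,b}=\frac{\Gamma(a+b+2)}{2^{a+b+1}\Gamma(a+1)\Gamma(b+1)}$ be the infinite tensor product of the Jacobi probability measure on $[-1,1]^\infty$. Let $J_k=c_k^{a,b}P_k^{(a,b)}$ ($P_k^{(a,b)}$ the classical Jacobi polynomial) be the Jacobi polynomials normalized in $L_2$ of the one-dimensional Jacobi probability measure, where $c_0^{a,b}=1$ and $$c_k^{a,b}=\sqrt{\frac{(2k+a+b+1)\,k!\,\Gamma(k+a+b+1)\Gamma(a+1)\Gamma(b+1)}{\Gamma(k+a+1)\Gamma(k+b+1)\Gamma(a+b+2)}},\qquad k\ge 1,$$ and let $J_s(y)=\prod_j J_{s_j}(y_j)$. For a Hilbert space $X$ and $v\in L_2([-1,1]^\infty,X,\nu_{a,b})$ put $v_s=\int v\,J_s\,d\nu_{a,b}\in X$. A *ReLU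 network* with $L\ge 2$ layers consists of widths $N_0$ (input dimension), $N_1,\dots,N_L$ (output dimension $N_L$), all positive, and weights and biases $(W^\ell,b^\ell)$, $1\le\ell\le L$, and computes $z^0=x$, $z^\ell=\sigma(W^\ell(z^0,\dots,z^{\ell-1})^{T}+b^\ell)$ for $1\le \ell<L$ with $\sigma(t)=\max\{t,0\}$, and the output $z^L=W^L(z^0,\dots,z^{L-1})^{T}+b^L$. Its depth is $L$, its size is the number of its nonzero weights and biases, and it is called deep if $L\ge3$. **Assumptions.** Let $(\delta_j)$ be a sequence of numbers $>1$ with $(\delta_j^{-1})\in\ell_q(\mathbb N)$ and $(\rho_j)$ a sequence of positive numbers with $c_k^{a,b}\rho_j^{-k}\le\delta_j^{-k}$ for all $k,j\in\mathbb N$, $k\ge 1$. For $s\in\mathbb F$ set $\sigma_s=c_s^{-1}\prod_j\rho_j^{s_j}$, $c_s=\prod_j c_{s_j}^{a,b}$, and for $\xi>0$ let $\Lambda(\xi)=\{s\in\mathbb F:\sigma_s^q\le\xi\}$. **Theorem.** There are positive constants $K,C,C_1,C_2$, depending only on $a,b,q,(\delta_j),(\rho_j)$, such that for every integer $n>1$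 there are a number $\xi_n>1$ with $C_1\frac{n}{\log n}\le\xi_n\le C_2\frac{n}{\log n}$ for which $\Lambda(\xi_n)$ is finite, and, with $m=\lfloor K\frac{n}{\log n}\rfloor$, a deep ReLU network $\boldsymbol\phi=(\phi_s)_{s\in\Lambda(\xi_n)}$ on $\mathbb R^m$ together with distinct coordinates $j_1,\dots,j_m\in\mathbb N$ (which are the first $m$ coordinates, in order, if $(\rho_j)$ is non-decreasing), with the following properties. 1. The network and the coordinates depend only on $n$ and $a,b,q,(\delta_j),(\rho_j)$; they depend neither on $X$ nor on $v$. 2. The input dimension is $m$ and the output dimension $|\Lambda(\xi_n)|$ is at most $m$. 3. The size of $\boldsymbol\phi$ is at most $n$. 4. The depth of $\boldsymbol\phi$ is at most $C(\log n)^2$. 5. For every Hilbert space $X$, every $M$ and every $v\in L_2([-1,1]^\infty,X,\nu_{a,b})$ with $\bigl(\sum_{s\in\mathbb F}(\sigma_s\|v_s\|_X)^2\bigr)^{1/2}\le M<\infty$, the approximant $\Phi v(y)=\sum_{s\in\Lambda(\xi_n)}v_s\,\phi_s(y_{j_1},\dots,y_{j_m})$ satisfies $$\|v-\Phi v\|_{L_2([-1,1]^\infty,X,\nu_{a,b})}\le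 C\,M\left(\frac{n}{\log n}\right)^{-1/q}.$$ -/

import Mathlib

open MeasureTheory ProbabilityTheory

noncomputable section

namespace JacobiReLU

/-! ## ReLU networks with connections to all preceding layers -/

/-- A feed-forward ReLU network in which a layer may use all preceding layers.
`width 0` is the input dimension, `width depth` the output dimension; `weight ℓ j i k` is the weight
of the connection from neuron `k` of layer `i < ℓ` to neuron `j` of layer `ℓ`.
Only the layers `1, …, depth` have a meaning. -/
structure ReLUNetwork where
  depth : ℕ
  two_le_depth : 2 ≤ depth
  width : ℕ → ℕ
  width_pos : ∀ ℓ ≤ depth, 0 < width ℓ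
  weight : (ℓ : ℕ) → Fin (width ℓ) → (i : Fin ℓ) → Fin (width i) → ℝ
  bias : (ℓ : ℕ) → Fin (width ℓ) → ℝ

namespace ReLUNetwork

variable (Φ : ReLUNetwork)

/-- The input dimension. -/
def inputDim : ℕ := Φ.width 0

/-- The output dimension. -/
def outputDim : ℕ := Φ.width Φ.depth

/-- The state `z^ℓ` of layer `ℓ` when the ReLU activation is applied in all layers `1, …, ℓ`. -/
def layer (x : Fin Φ.inputDim → ℝ) : (ℓ : ℕ) → Fin (Φ.width ℓ) → ℝ
  | 0 => x
  | ℓ + 1 => fun j =>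
      max (∑ i : Fin (ℓ + 1), ∑ k : Fin (Φ.width i),
        Φ.weight (ℓ + 1) j i k * layer x i k + Φ.bias (ℓ + 1) j) 0
  termination_by ℓ => ℓ
  decreasing_by exact i.isLt

/-- The function realized by the network: the last layer is affine, without activation. -/
def eval (x : Fin Φ.inputDim → ℝ) (j : Fin Φ.outputDim) : ℝ :=
  ∑ i : Fin Φ.depth, ∑ k : Fin (Φ.width i),
    Φ.weight Φ.depth j i k * Φ.layer x i k + Φ.bias Φ.depth j

open scoped Classical in
/-- The size: the number of nonzero weights and nonzero biases in the layers `1, …, depth`. -/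
def size : ℕ :=
  ∑ ℓ ∈ Finset.Icc 1 Φ.depth, ∑ j : Fin (Φ.width ℓ),
    ((∑ i : Fin ℓ, ∑ k : Fin (Φ.width i), if Φ.weight ℓ j i k = 0 then 0 else 1) +
      if Φ.bias ℓ j = 0 then 0 else 1)

end ReLUNetwork

/-! ## The Jacobi probability measure on `[-1,1]` and its infinite power -/

/-- The interval `[-1,1]`. -/
abbrev II : Type := Set.Icc (-1 : ℝ) 1

/-- The density `c_{a,b} (1-y)^a (1+y)^b`. -/
def jacobiDensity (a b y : ℝ) : ℝ :=
  Real.Gamma (a + b + 2) / (2 ^ (a + b + 1) * Real.Gamma (a + 1) * Real.Gamma (b + 1)) *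
    (1 - y) ^ a * (1 + y) ^ b

/-- The Jacobi probability measure on `[-1,1]`. -/
def jacobiMeasure (a b : ℝ) : Measure II :=
  ((volume : Measure ℝ).withDensity fun y => ENNReal.ofReal (jacobiDensity a b y)).comap
    ((↑) : II → ℝ)

lemma isProbabilityMeasure_jacobiMeasure {a b : ℝ} (ha : -1 < a) (hb : -1 < b) :
    IsProbabilityMeasure (jacobiMeasure a b) := by
  constructor
  have h0 : MeasurableSet (Set.Icc (-1 : ℝ) 1) := measurableSet_Icc
  rw [jacobiMeasure, (MeasurableEmbedding.subtype_coe h0).comap_apply, Set.image_univ,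
    Subtype.range_coe, withDensity_apply _ h0, ← restrict_Ioo_eq_restrict_Icc]
  have him : (fun x : ℝ => 2 * x - 1) '' Set.Ioo 0 1 = Set.Ioo (-1) 1 := by
    ext y
    simp only [Set.mem_image, Set.mem_Ioo]
    constructor
    · rintro ⟨x, hx, rfl⟩
      constructor <;> linarith [hx.1, hx.2]
    · intro hy
      exact ⟨(y + 1) / 2, ⟨by linarith [hy.1], by linarith [hy.2]⟩, by ring⟩
  rw [← him, lintegral_image_eq_lintegral_abs_deriv_mul (f' := fun _ => 2) measurableSet_Ioo
    (fun x _ => (by simpa using ((hasDerivAt_id' x).const_mul (2 : ℝ)).sub_const 1 :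
      HasDerivAt (fun x : ℝ => 2 * x - 1) 2 x).hasDerivWithinAt)
    (fun x _ y _ h => by linarith [show 2 * x - 1 = 2 * y - 1 from h]),
    ← lintegral_betaPDF_eq_one (α := b + 1) (β := a + 1) (by linarith) (by linarith),
    lintegral_betaPDF]
  refine setLIntegral_congr_fun measurableSet_Ioo fun x hx => ?_
  rw [← ENNReal.ofReal_mul (abs_nonneg _)]
  congr 1
  have h1 : (1 - (2 * x - 1)) = 2 * (1 - x) := by ring
  have h2 : (1 + (2 * x - 1)) = 2 * x := by ring
  have hx1 : 0 ≤ 1 - x := by linarith [hx.2]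
  have hA := Real.Gamma_pos_of_pos (show 0 < a + 1 by linarith)
  have hB := Real.Gamma_pos_of_pos (show 0 < b + 1 by linarith)
  have hC := Real.Gamma_pos_of_pos (show 0 < a + b + 2 by linarith)
  rw [jacobiDensity, h1, h2, Real.mul_rpow (by norm_num) hx1,
    Real.mul_rpow (by norm_num) hx.1.le, ProbabilityTheory.beta,
    show b + 1 + (a + 1) = a + b + 2 by ring, Real.rpow_add (by norm_num),
    Real.rpow_add (by norm_num), Real.rpow_one, abs_of_pos (by norm_num : (0 : ℝ) < 2),
    add_sub_cancel_right, add_sub_cancel_right]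
  have h2a : (0 : ℝ) < 2 ^ a := Real.rpow_pos_of_pos (by norm_num) a
  have h2b : (0 : ℝ) < 2 ^ b := Real.rpow_pos_of_pos (by norm_num) b
  field_simp

/-- The infinite tensor product `ν_{a,b}` on `[-1,1]^∞`. -/
def jacobiProductMeasure (a b : ℝ) : Measure (ℕ → II) :=
  Measure.infinitePi fun _ : ℕ => jacobiMeasure a b

/-! ## Jacobi polynomials and the gpc expansion -/

/-- The constants `c_k^{a,b}`. -/
def jacobiConst (a b : ℝ) (k : ℕ) : ℝ :=
  if k = 0 then 1 else
    √((2 * k + a + b + 1) * (k.factorial : ℝ) * Real.Gamma (k + a + b + 1) *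
        Real.Gamma (a + 1) * Real.Gamma (b + 1) /
      (Real.Gamma (k + a + 1) * Real.Gamma (k + b + 1) * Real.Gamma (a + b + 2)))

/-- The classical Jacobi polynomial
`P_k^{(a,b)}(y) = ∑_m binom(k+a, k-m) binom(k+b, m) ((y-1)/2)^m ((y+1)/2)^(k-m)`. -/
def classicalJacobi (a b : ℝ) (k : ℕ) (y : ℝ) : ℝ :=
  ∑ m ∈ Finset.range (k + 1), Ring.choose (k + a) (k - m) * Ring.choose (k + b) m *
    ((y - 1) / 2) ^ m * ((y + 1) / 2) ^ (k - m)

/-- The Jacobi polynomial `J_k`, normalized in `L_2` of the Jacobi probability measure. -/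
def jacobi (a b : ℝ) (k : ℕ) (y : ℝ) : ℝ :=
  jacobiConst a b k * classicalJacobi a b k y

lemma iteratedDeriv_one_add_rpow (p : ℝ) (k : ℕ) (y : ℝ) :
    iteratedDeriv k (fun t : ℝ => (1 + t) ^ p) y =
      k.factorial * Ring.choose p k * (1 + y) ^ (p - k) := by
  rw [iteratedDeriv_comp_const_add k (fun t : ℝ => t ^ p) 1]
  simp only [iteratedDeriv_eq_iterate, Real.iter_deriv_rpow_const]
  rw [← nsmul_eq_mul, ← Ring.descPochhammer_eq_factorial_smul_choose, Polynomial.eval_eq_smeval,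
    ← descPochhammer_map (Int.castRingHom ℝ), ← Polynomial.eval_eq_smeval, Polynomial.eval_map,
    ← Polynomial.eval₂_smulOneHom_eq_smeval]
  congr 3
  exact Subsingleton.elim _ _

lemma iteratedDeriv_one_sub_rpow (p : ℝ) (k : ℕ) (y : ℝ) :
    iteratedDeriv k (fun t : ℝ => (1 - t) ^ p) y =
      (-1) ^ k * (k.factorial * Ring.choose p k * (1 - y) ^ (p - k)) := by
  rw [iteratedDeriv_comp_const_sub k (fun t : ℝ => t ^ p) 1]
  have h := iteratedDeriv_one_add_rpow p k (-y)
  rw [iteratedDeriv_comp_const_add k (fun t : ℝ => t ^ p) 1] at h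
  simp only [smul_eq_mul, sub_eq_add_neg] at h ⊢
  rw [h]

/-- Rodrigues' formula for the normalized Jacobi polynomials. -/
theorem jacobi_rodrigues (a b : ℝ) (k : ℕ) {y : ℝ} (hy : y ∈ Set.Ioo (-1 : ℝ) 1) :
    jacobi a b k y = jacobiConst a b k / (k.factorial * 2 ^ k) * (1 - y) ^ (-a) * (1 + y) ^ (-b) *
      iteratedDeriv k (fun t : ℝ => (t ^ 2 - 1) ^ k * (1 - t) ^ a * (1 + t) ^ b) y := by
  have h1 : 0 < 1 - y := by linarith [hy.2]
  have h2 : 0 < 1 + y := by linarith [hy.1]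
  have hev : (fun t : ℝ => (t ^ 2 - 1) ^ k * (1 - t) ^ a * (1 + t) ^ b) =ᶠ[nhds y]
      fun t => (-1) ^ k * ((1 - t) ^ (k + a) * (1 + t) ^ (k + b)) := by
    filter_upwards [Ioo_mem_nhds hy.1 hy.2] with t ht
    have h1 : 0 < 1 - t := by linarith [ht.2]
    have h2 : 0 < 1 + t := by linarith [ht.1]
    rw [Real.rpow_add h1, Real.rpow_add h2, Real.rpow_natCast, Real.rpow_natCast,
      show t ^ 2 - 1 = (-1) * ((1 - t) * (1 + t)) by ring, mul_pow, mul_pow]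
    ring
  rw [hev.iteratedDeriv_eq, iteratedDeriv_const_mul_field, iteratedDeriv_fun_mul
    (ContDiffAt.rpow_const_of_ne (by fun_prop) h1.ne')
    (ContDiffAt.rpow_const_of_ne (by fun_prop) h2.ne'), jacobi, classicalJacobi,
    ← Finset.sum_range_reflect, Finset.mul_sum, Finset.mul_sum, Finset.mul_sum]
  refine Finset.sum_congr rfl fun i hi => ?_
  have hik : i ≤ k := Nat.lt_succ_iff.mp (Finset.mem_range.mp hi)
  obtain ⟨l, rfl⟩ := Nat.exists_eq_add_of_le hik
  have e1 : i + l + 1 - 1 - i = l := by omega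
  have e2 : i + l - l = i := by omega
  have e3 : i + l - i = l := by omega
  have hc : ((i + l).choose i : ℝ) * (i.factorial * l.factorial) = (i + l).factorial := by
    have := Nat.choose_mul_factorial_mul_factorial (Nat.le_add_right i l)
    rw [e3] at this
    rw [← mul_assoc]; exact_mod_cast this
  rw [e1, e2, e3, iteratedDeriv_one_add_rpow, iteratedDeriv_one_sub_rpow]
  have p1 : (1 - y) ^ (((i + l : ℕ) : ℝ) + a - i) = (1 - y) ^ l * (1 - y) ^ a := by
    rw [show ((i + l : ℕ) : ℝ) + a - i = (l : ℝ) + a by push_cast; ring, Real.rpow_add h1,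
      Real.rpow_natCast]
  have p2 : (1 + y) ^ (((i + l : ℕ) : ℝ) + b - l) = (1 + y) ^ i * (1 + y) ^ b := by
    rw [show ((i + l : ℕ) : ℝ) + b - l = (i : ℝ) + b by push_cast; ring, Real.rpow_add h2,
      Real.rpow_natCast]
  rw [p1, p2, Real.rpow_neg h1.le, Real.rpow_neg h2.le, ← hc]
  have ha := (Real.rpow_pos_of_pos h1 a).ne'
  have hb := (Real.rpow_pos_of_pos h2 b).ne'
  have hf := (Nat.cast_ne_zero (R := ℝ)).mpr (Nat.factorial_ne_zero (i + l))
  have hch := (Nat.cast_ne_zero (R := ℝ)).mpr (Nat.choose_pos (Nat.le_add_right i l)).ne'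
  have hfi := (Nat.cast_ne_zero (R := ℝ)).mpr (Nat.factorial_ne_zero i)
  have hfl := (Nat.cast_ne_zero (R := ℝ)).mpr (Nat.factorial_ne_zero l)
  rw [show (y - 1) / 2 = (-1) * ((1 - y) / 2) by ring, show (y + 1) / 2 = (1 + y) / 2 by ring,
    mul_pow, div_pow, div_pow, pow_add (2 : ℝ), pow_add (-1 : ℝ)]
  have hs : ((-1 : ℝ) ^ i) * (-1) ^ i = 1 := by rw [← mul_pow]; norm_num
  field_simp
  linear_combination (-(jacobiConst a b (i + l) * Ring.choose ((i + l : ℕ) + a) i *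
    Ring.choose ((i + l : ℕ) + b) l)) * hs

/-- The tensor product polynomial `J_s`, `s` a finitely supported multi-index. (`J_0 = 1`, so
only the indices in the support of `s` contribute.) -/
def jacobiTensor (a b : ℝ) (s : ℕ →₀ ℕ) (y : ℕ → II) : ℝ :=
  ∏ j ∈ s.support, jacobi a b (s j) (y j)

/-- The gpc coefficient `v_s = ∫ v J_s dν_{a,b}`. -/
def gpcCoeff {X : Type*} [NormedAddCommGroup X] [NormedSpace ℝ X] (a b : ℝ)
    (v : (ℕ → II) → X) (s : ℕ →₀ ℕ) : X :=
  ∫ y, jacobiTensor a b s y • v y ∂(jacobiProductMeasure a b)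

/-- The weight `σ_s = c_s⁻¹ ∏_j ρ_j^{s_j}` with `c_s = ∏_j c_{s_j}^{a,b}`. -/
def gpcWeight (a b : ℝ) (ρ : ℕ → ℝ) (s : ℕ →₀ ℕ) : ℝ :=
  (∏ j ∈ s.support, jacobiConst a b (s j))⁻¹ * ∏ j ∈ s.support, ρ j ^ s j

/-- The index set `Λ(ξ) = {s : σ_s^q ≤ ξ}`. -/
def indexSet (a b q : ℝ) (ρ : ℕ → ℝ) (ξ : ℝ) : Set (ℕ →₀ ℕ) :=
  {s | gpcWeight a b ρ s ^ q ≤ ξ}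

end JacobiReLU

end

noncomputable section

namespace JacobiReLU

/-! The `J_s` are orthonormal and, with coefficients in `X`, complete in `L_2`. Outside `Λ(ξ)` one
has `σ_s > ξ^(1/q)`, so truncating the expansion to `Λ(ξ)` costs at most `ξ^(-1/q) M`
(`eLpNorm_sub_indexSet_sum_le`). For `ξ` of order `n / log n` this is the asserted rate. It remains
to realize all `J_s`, `s ∈ Λ(ξ)`, by one network of size at most `n` with an error that is a
sufficiently high negative power of `n`.

The index set is controlled by a Markov-type argument. Since `σ_s ≥ ∏ δ_j^(s_j)`, every `s ∈ Λ(ξ)`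
satisfies `1 ≤ ξ ∏ (δ_j^(-q))^(s_j)`. The generating function `∑_s ∏ (s_j+1)^2 (δ_j^(-q))^(s_j)` is
finite, so `∑_{s ∈ Λ(ξ)} ∏ (s_j+1)^2` is at most a multiple of `ξ` (`sum_prod_sq_le`). As `δ_j^(-q)
≤ t < 1` uniformly in `j`, total degrees in `Λ(ξ)` are `O(log n)`.

Expanded in the Bernstein terms `∏ u_j^i (1-u_j)^(s_j-i)`, `u_j = (1+y_j)/2`, the polynomial `J_s`
has `∏ (s_j+1)` terms, each a product of exactly `|s|` factors in `[0,1]`. One multiplication of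
numbers in `[0,1]` with error `4^(-K)` takes `O(K)` neurons: `p t = ((p+t)/2)^2 - (|p-t|/2)^2`, and
squares are approximated by sums of iterated tooth functions. The coefficients of `J_s` have
absolute sum at most `D^|s|`, which `K` of order `log n` outweighs. Since `|s| + 1 ≤ ∏ (s_j+1)`, the
size is `O(K ∑ ∏ (s_j+1)^2) = O(ξ log n)`, and the depth is `O(|s| K) = O((log n)^2)`. -/

/-! ### Orthonormality of the Jacobi polynomials in one variable -/

open Polynomial in
lemma ringChoose_succ_right (r : ℝ) (n : ℕ) :
    Ring.choose r (n + 1) = Ring.choose r n * ((r - n) / (n + 1)) := by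
  have h0 := Ring.descPochhammer_eq_factorial_smul_choose r n
  have h1 := Ring.descPochhammer_eq_factorial_smul_choose r (n + 1)
  have key : (descPochhammer ℤ (n + 1)).smeval r = (descPochhammer ℤ n).smeval r * (r - n) := by
    rw [descPochhammer_succ_right, smeval_mul, smeval_sub, smeval_X, pow_one, smeval_natCast]
    simp
  rw [key, h0, Nat.factorial_succ, nsmul_eq_mul, nsmul_eq_mul] at h1
  push_cast at h1
  have hf : (n.factorial : ℝ) ≠ 0 := by positivity
  have hn : (n : ℝ) + 1 ≠ 0 := by positivity
  field_simp
  apply mul_left_cancel₀ hf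
  linarith

lemma ringChoose_eq_Gamma (r : ℝ) (n : ℕ) (h : 0 < r - n + 1) :
    Ring.choose r n = Real.Gamma (r + 1) / (n.factorial * Real.Gamma (r - n + 1)) := by
  induction n with
  | zero =>
    simp only [Ring.choose_zero_right, Nat.factorial_zero, Nat.cast_one, one_mul, Nat.cast_zero,
      sub_zero]
    rw [div_self]
    simp only [Nat.cast_zero, sub_zero] at h
    exact (Real.Gamma_pos_of_pos h).ne'
  | succ n ih =>
    push_cast at h ⊢
    have h' : 0 < r - n := by linarith
    rw [ringChoose_succ_right, ih (by linarith), Real.Gamma_add_one h'.ne', Nat.factorial_succ,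
      show r - (n + 1) + 1 = r - n by ring]
    have := (Real.Gamma_pos_of_pos h').ne'
    push_cast
    field_simp

lemma Gamma_add_natCast_eq (x : ℝ) (hx : 0 < x) (n : ℕ) :
    Real.Gamma (x + n) = Real.Gamma x * (ascPochhammer ℝ n).eval x := by
  induction n with
  | zero => simp
  | succ n ih =>
    rw [ascPochhammer_succ_right, Polynomial.eval_mul, ← mul_assoc, ← ih]
    push_cast
    rw [← add_assoc, Real.Gamma_add_one (by positivity)]
    simp
    ring

/-- The integral of a function against the Jacobi measure. -/
lemma integral_jacobiMeasure (a b : ℝ) (ha : -1 < a) (hb : -1 < b) (f : ℝ → ℝ) :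
    ∫ y, f y ∂(jacobiMeasure a b) = ∫ y in Set.Ioo (-1 : ℝ) 1, jacobiDensity a b y * f y := by
  have hm : Measurable (jacobiDensity a b) := by unfold jacobiDensity; fun_prop
  have h0 : MeasurableSet (Set.Icc (-1 : ℝ) 1) := measurableSet_Icc
  have hemb := MeasurableEmbedding.subtype_coe h0
  rw [jacobiMeasure]
  have h1 := hemb.integral_map (μ := ((volume : Measure ℝ).withDensity
    fun y => ENNReal.ofReal (jacobiDensity a b y)).comap ((↑) : II → ℝ)) f
  rw [← h1, hemb.map_comap, Subtype.range_coe, restrict_withDensity h0,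
    ← restrict_Ioo_eq_restrict_Icc,
    integral_withDensity_eq_integral_toReal_smul (by fun_prop) (by simp)]
  refine setIntegral_congr_fun measurableSet_Ioo fun y hy => ?_
  simp only [smul_eq_mul]
  rw [ENNReal.toReal_ofReal]
  have h1 : 0 < 1 - y := by linarith [hy.2]
  have h2 : 0 < 1 + y := by linarith [hy.1]
  have hA := Real.Gamma_pos_of_pos (show 0 < a + 1 by linarith)
  have hB := Real.Gamma_pos_of_pos (show 0 < b + 1 by linarith)
  have hC := Real.Gamma_pos_of_pos (show 0 < a + b + 2 by linarith)
  unfold jacobiDensity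
  positivity

lemma setIntegral_jacobiDensity (a b : ℝ) (ha : -1 < a) (hb : -1 < b) :
    ∫ y in Set.Ioo (-1 : ℝ) 1, jacobiDensity a b y = 1 := by
  have := isProbabilityMeasure_jacobiMeasure ha hb
  have h := integral_jacobiMeasure a b ha hb (fun _ => 1)
  simpa using h.symm

/-- Multiplying the density by the monomial gives a multiple of the density with parameters `a + r`,
`b + p`, which has integral one; the right-hand side is the quotient of the normalizing constants.
-/
lemma integral_beta_monomial (a b : ℝ) (ha : -1 < a) (hb : -1 < b) (p r : ℕ) :
    ∫ y, ((1 + (y : ℝ)) / 2) ^ p * ((1 - (y : ℝ)) / 2) ^ r ∂(jacobiMeasure a b) =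
      Real.Gamma (a + b + 2) * Real.Gamma (a + r + 1) * Real.Gamma (b + p + 1) /
        (Real.Gamma (a + 1) * Real.Gamma (b + 1) * Real.Gamma (a + b + 2 + p + r)) := by
  have hp : (0 : ℝ) ≤ p := by positivity
  have hr : (0 : ℝ) ≤ r := by positivity
  rw [integral_jacobiMeasure a b ha hb fun y => ((1 + y) / 2) ^ p * ((1 - y) / 2) ^ r]
  have hA := (Real.Gamma_pos_of_pos (show 0 < a + 1 by linarith)).ne'
  have hB := (Real.Gamma_pos_of_pos (show 0 < b + 1 by linarith)).ne'
  have hC := (Real.Gamma_pos_of_pos (show 0 < a + r + 1 by linarith)).ne'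
  have hD := (Real.Gamma_pos_of_pos (show 0 < b + p + 1 by linarith)).ne'
  have hE := (Real.Gamma_pos_of_pos (show 0 < a + b + 2 + p + r by linarith)).ne'
  have hone := setIntegral_jacobiDensity (a + r) (b + p) (by linarith) (by linarith)
  refine Eq.trans ?_ ((congrArg (Real.Gamma (a + b + 2) * Real.Gamma (a + r + 1) *
    Real.Gamma (b + p + 1) / (Real.Gamma (a + 1) * Real.Gamma (b + 1) *
      Real.Gamma (a + b + 2 + p + r)) * ·) hone).trans (mul_one _))
  simp only [← integral_const_mul]
  refine setIntegral_congr_fun measurableSet_Ioo fun y hy => ?_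
  have h1 : 0 < 1 - y := by linarith [hy.2]
  have h2 : 0 < 1 + y := by linarith [hy.1]
  simp only [jacobiDensity]
  rw [Real.rpow_add h1, Real.rpow_add h2, Real.rpow_natCast, Real.rpow_natCast, div_pow, div_pow,
    show a + r + (b + p) + 2 = a + b + 2 + p + r by ring,
    show a + r + (b + p) + 1 = a + b + 1 + p + r by ring,
    Real.rpow_add (by norm_num : (0 : ℝ) < 2) (a + b + 1 + p),
    Real.rpow_add (by norm_num : (0 : ℝ) < 2) (a + b + 1), Real.rpow_natCast, Real.rpow_natCast]
  have h2a : (2 : ℝ) ^ (a + b + 1) ≠ 0 := (Real.rpow_pos_of_pos (by norm_num) _).ne'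
  field_simp

/-- The classical Jacobi polynomial as a polynomial in the variable `(1 + y) / 2`. -/
def jacobiPoly (a b : ℝ) (k : ℕ) : Polynomial ℝ :=
  ∑ i ∈ Finset.range (k + 1), Polynomial.C (Ring.choose (k + a) i * Ring.choose (k + b) (k - i)) *
    ((Polynomial.X - 1) ^ (k - i) * Polynomial.X ^ i)

lemma classicalJacobi_eq_eval (a b : ℝ) (k : ℕ) (y : ℝ) :
    classicalJacobi a b k y = (jacobiPoly a b k).eval ((1 + y) / 2) := by
  rw [classicalJacobi, jacobiPoly, Polynomial.eval_finsetSum, ← Finset.sum_range_reflect]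
  refine Finset.sum_congr rfl fun i hi => ?_
  have : i ≤ k := Nat.lt_succ_iff.mp (Finset.mem_range.mp hi)
  rw [show k + 1 - 1 - i = k - i by omega, show k - (k - i) = i by omega]
  simp only [Polynomial.eval_mul, Polynomial.eval_C, Polynomial.eval_pow, Polynomial.eval_sub,
    Polynomial.eval_X, Polynomial.eval_one]
  rw [show (1 + y) / 2 - 1 = (y - 1) / 2 by ring, add_comm y 1, mul_assoc]

lemma natDegree_X_sub_one_pow_mul_X_pow {k i : ℕ} (hi : i ≤ k) :
    ((Polynomial.X - 1 : Polynomial ℝ) ^ (k - i) * Polynomial.X ^ i).natDegree = k ∧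
    ((Polynomial.X - 1 : Polynomial ℝ) ^ (k - i) * Polynomial.X ^ i).Monic := by
  have h1 : (Polynomial.X - 1 : Polynomial ℝ).Monic := by
    simpa using Polynomial.monic_X_sub_C (1 : ℝ)
  have h1' : (Polynomial.X - 1 : Polynomial ℝ).natDegree = 1 := by
    simpa using Polynomial.natDegree_X_sub_C (1 : ℝ)
  refine ⟨?_, (h1.pow _).mul (Polynomial.monic_X.pow _)⟩
  rw [(h1.pow _).natDegree_mul (Polynomial.monic_X.pow _), h1.natDegree_pow, h1']
  simp
  omega

lemma natDegree_jacobiPoly_le (a b : ℝ) (k : ℕ) : (jacobiPoly a b k).natDegree ≤ k := by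
  refine Polynomial.natDegree_sum_le_of_forall_le _ _ fun i hi => ?_
  refine (Polynomial.natDegree_C_mul_le _ _).trans ?_
  exact (natDegree_X_sub_one_pow_mul_X_pow (Nat.lt_succ_iff.mp (Finset.mem_range.mp hi))).1.le

/-- Each `(X-1)^(k-i) X^i` is monic of degree `k`, so the top coefficient is a Chu–Vandermonde sum.
-/
lemma coeff_jacobiPoly (a b : ℝ) (k : ℕ) :
    (jacobiPoly a b k).coeff k = Ring.choose (k + a + (k + b)) k := by
  rw [Ring.add_choose_eq k (Commute.all _ _), Finset.Nat.sum_antidiagonal_eq_sum_range_succ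
    (fun i j => Ring.choose (k + a) i * Ring.choose (k + b) j), jacobiPoly,
    Polynomial.finsetSum_coeff]
  refine Finset.sum_congr rfl fun i hi => ?_
  obtain ⟨h1, h2⟩ := natDegree_X_sub_one_pow_mul_X_pow (Nat.lt_succ_iff.mp (Finset.mem_range.mp hi))
  rw [Polynomial.coeff_C_mul]
  have := h2.coeff_natDegree
  rw [h1] at this
  rw [this, mul_one]

lemma integrable_eval_poly (a b : ℝ) (ha : -1 < a) (hb : -1 < b) (P : Polynomial ℝ) :
    Integrable (fun y : II => P.eval ((1 + (y : ℝ)) / 2)) (jacobiMeasure a b) := by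
  have := isProbabilityMeasure_jacobiMeasure ha hb
  have : CompactSpace II := isCompact_iff_compactSpace.mp isCompact_Icc
  have hc : Continuous (fun y : II => P.eval ((1 + (y : ℝ)) / 2)) := by fun_prop
  exact (BoundedContinuousFunction.mkOfCompact ⟨_, hc⟩).integrable _

/-- Finite differences replace integration by parts. After the Beta integrals are inserted, the only
dependence on `i` is `(-1)^(k-i) binom(k,i)` times `Γ(i+b+1+j)/Γ(i+b+1)`, and the latter is a
polynomial of degree `j` in `i`. The sum is its `k`-th forward difference: zero for `j < k`,
explicit for `j = k`. -/
lemma integral_jacobiPoly_mul_X_pow (a b : ℝ) (ha : -1 < a) (hb : -1 < b) (k j : ℕ) :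
    ∫ y, (jacobiPoly a b k).eval ((1 + (y : ℝ)) / 2) * ((1 + (y : ℝ)) / 2) ^ j
        ∂(jacobiMeasure a b) =
      Real.Gamma (k + a + 1) * Real.Gamma (k + b + 1) * Real.Gamma (a + b + 2) /
        (k.factorial * (Real.Gamma (a + 1) * Real.Gamma (b + 1) * Real.Gamma (a + b + 2 + k + j))) *
        (fwdDiff (1 : ℝ))^[k]
          (fun x => ((ascPochhammer ℝ j).comp (Polynomial.X + Polynomial.C (b + 1))).eval x) 0 := by
  have e : ∀ y : II, (jacobiPoly a b k).eval ((1 + (y : ℝ)) / 2) * ((1 + (y : ℝ)) / 2) ^ j =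
      ∑ i ∈ Finset.range (k + 1), (Ring.choose (k + a) i * Ring.choose (k + b) (k - i) *
        (-1) ^ (k - i)) * (((1 + (y : ℝ)) / 2) ^ (i + j) * ((1 - (y : ℝ)) / 2) ^ (k - i)) := by
    intro y
    rw [jacobiPoly, Polynomial.eval_finsetSum, Finset.sum_mul]
    refine Finset.sum_congr rfl fun i _ => ?_
    simp only [Polynomial.eval_mul, Polynomial.eval_C, Polynomial.eval_pow, Polynomial.eval_sub,
      Polynomial.eval_X, Polynomial.eval_one]
    rw [show (1 + (y : ℝ)) / 2 - 1 = (-1) * ((1 - (y : ℝ)) / 2) by ring, mul_pow, pow_add]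
    ring
  simp_rw [e]
  rw [integral_finsetSum, fwdDiff_iter_eq_sum_shift, Finset.mul_sum]
  swap
  · intro i _
    refine Integrable.const_mul ?_ _
    have := integrable_eval_poly a b ha hb
      (Polynomial.X ^ (i + j) * (1 - Polynomial.X) ^ (k - i))
    refine this.congr (Filter.Eventually.of_forall fun y => ?_)
    simp only [Polynomial.eval_mul, Polynomial.eval_pow, Polynomial.eval_sub,
      Polynomial.eval_X, Polynomial.eval_one]
    rw [show 1 - (1 + (y : ℝ)) / 2 = (1 - (y : ℝ)) / 2 by ring]
  refine Finset.sum_congr rfl fun i hi => ?_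
  have hik : i ≤ k := Nat.lt_succ_iff.mp (Finset.mem_range.mp hi)
  have hi0 : (0 : ℝ) ≤ i := by positivity
  have hki : (0 : ℝ) ≤ (k : ℝ) - i := by simpa using hik
  have hk0 : (0 : ℝ) ≤ k := by positivity
  have hj0 : (0 : ℝ) ≤ j := by positivity
  rw [integral_const_mul, integral_beta_monomial a b ha hb,
    ringChoose_eq_Gamma _ _ (by linarith), ringChoose_eq_Gamma _ _ (by
      rw [Nat.cast_sub hik]; linarith)]
  simp only [zero_add, Polynomial.eval_comp, Polynomial.eval_add, Polynomial.eval_X,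
    Polynomial.eval_C, nsmul_eq_mul, mul_one, zsmul_eq_mul]
  have hG := Gamma_add_natCast_eq (i + (b + 1)) (by linarith) j
  have hc : (k.choose i : ℝ) * (i.factorial * (k - i).factorial) = k.factorial := by
    rw [← mul_assoc]; exact_mod_cast Nat.choose_mul_factorial_mul_factorial hik
  push_cast [Nat.cast_sub hik]
  rw [show (b + (i + j) + 1 : ℝ) = i + (b + 1) + j by ring, hG,
    show (k + a - i + 1 : ℝ) = a + (k - i) + 1 by ring,
    show (k + b - (k - i) + 1 : ℝ) = i + (b + 1) by ring,
    show (a + b + 2 + (i + j) + (k - i) : ℝ) = a + b + 2 + k + j by ring, ← hc]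
  have hA := (Real.Gamma_pos_of_pos (show 0 < a + 1 by linarith)).ne'
  have hB := (Real.Gamma_pos_of_pos (show 0 < b + 1 by linarith)).ne'
  have hC := (Real.Gamma_pos_of_pos (show 0 < a + (k - i) + 1 by linarith)).ne'
  have hD := (Real.Gamma_pos_of_pos (show 0 < i + (b + 1) by linarith)).ne'
  have hE := (Real.Gamma_pos_of_pos (show 0 < a + b + 2 + k + j by linarith)).ne'
  have hf1 : (i.factorial : ℝ) ≠ 0 := by positivity
  have hf2 : ((k - i).factorial : ℝ) ≠ 0 := by positivity
  have hf3 : (k.choose i : ℝ) ≠ 0 := by exact_mod_cast (Nat.choose_pos hik).ne'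
  field_simp

lemma ascPochhammer_comp_shift (c : ℝ) (j : ℕ) :
    ((ascPochhammer ℝ j).comp (Polynomial.X + Polynomial.C c)).natDegree = j ∧
    ((ascPochhammer ℝ j).comp (Polynomial.X + Polynomial.C c)).Monic := by
  constructor
  · rw [Polynomial.natDegree_comp, ascPochhammer_natDegree, Polynomial.natDegree_X_add_C, mul_one]
  · exact (monic_ascPochhammer ℝ j).comp_X_add_C c

lemma integral_jacobiPoly_mul_of_lt (a b : ℝ) (ha : -1 < a) (hb : -1 < b) {k j : ℕ} (h : j < k) :
    ∫ y, (jacobiPoly a b k).eval ((1 + (y : ℝ)) / 2) * ((1 + (y : ℝ)) / 2) ^ j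
        ∂(jacobiMeasure a b) = 0 := by
  rw [integral_jacobiPoly_mul_X_pow a b ha hb, Polynomial.fwdDiff_iter_eq_zero_of_degree_lt]
  · simp
  · rwa [(ascPochhammer_comp_shift _ _).1]

lemma integral_jacobiPoly_mul_self_pow (a b : ℝ) (ha : -1 < a) (hb : -1 < b) (k : ℕ) :
    ∫ y, (jacobiPoly a b k).eval ((1 + (y : ℝ)) / 2) * ((1 + (y : ℝ)) / 2) ^ k
        ∂(jacobiMeasure a b) =
      Real.Gamma (k + a + 1) * Real.Gamma (k + b + 1) * Real.Gamma (a + b + 2) /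
        (Real.Gamma (a + 1) * Real.Gamma (b + 1) * Real.Gamma (a + b + 2 + k + k)) := by
  rw [integral_jacobiPoly_mul_X_pow a b ha hb]
  have h := Polynomial.fwdDiff_iter_degree_eq_factorial
    ((ascPochhammer ℝ k).comp (Polynomial.X + Polynomial.C (b + 1)))
  rw [(ascPochhammer_comp_shift _ _).1, (ascPochhammer_comp_shift _ _).2.leadingCoeff] at h
  rw [h]
  have hf1 : (k.factorial : ℝ) ≠ 0 := by positivity
  simp
  field_simp

lemma integral_jacobiPoly_mul (a b : ℝ) (ha : -1 < a) (hb : -1 < b) (k : ℕ) (Q : Polynomial ℝ)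
    (hQ : Q.natDegree ≤ k) :
    ∫ y, (jacobiPoly a b k).eval ((1 + (y : ℝ)) / 2) * Q.eval ((1 + (y : ℝ)) / 2)
        ∂(jacobiMeasure a b) = Q.coeff k *
      (Real.Gamma (k + a + 1) * Real.Gamma (k + b + 1) * Real.Gamma (a + b + 2) /
        (Real.Gamma (a + 1) * Real.Gamma (b + 1) * Real.Gamma (a + b + 2 + k + k))) := by
  have e : ∀ y : II, (jacobiPoly a b k).eval ((1 + (y : ℝ)) / 2) * Q.eval ((1 + (y : ℝ)) / 2) =
      ∑ i ∈ Finset.range (k + 1), Q.coeff i *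
        ((jacobiPoly a b k).eval ((1 + (y : ℝ)) / 2) * ((1 + (y : ℝ)) / 2) ^ i) := by
    intro y
    rw [Polynomial.eval_eq_sum_range' (Nat.lt_succ_of_le hQ), Finset.mul_sum]
    exact Finset.sum_congr rfl fun i _ => by ring
  simp_rw [e]
  rw [integral_finsetSum, Finset.sum_range_succ, Finset.sum_eq_zero, zero_add,
    integral_const_mul, integral_jacobiPoly_mul_self_pow a b ha hb]
  · intro i hi
    rw [integral_const_mul, integral_jacobiPoly_mul_of_lt a b ha hb (Finset.mem_range.mp hi),
      mul_zero]
  · intro i _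
    refine Integrable.const_mul ?_ _
    have := integrable_eval_poly a b ha hb (jacobiPoly a b k * Polynomial.X ^ i)
    simpa using this

lemma jacobiConst_sq (a b : ℝ) (ha : -1 < a) (hb : -1 < b) (k : ℕ) (hk : k ≠ 0) :
    0 < (2 * k + a + b + 1) * (k.factorial : ℝ) * Real.Gamma (k + a + b + 1) *
        Real.Gamma (a + 1) * Real.Gamma (b + 1) /
      (Real.Gamma (k + a + 1) * Real.Gamma (k + b + 1) * Real.Gamma (a + b + 2)) := by
  have hk1 : (1 : ℝ) ≤ k := by exact_mod_cast Nat.one_le_iff_ne_zero.mpr hk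
  have h1 := Real.Gamma_pos_of_pos (show 0 < a + 1 by linarith)
  have h2 := Real.Gamma_pos_of_pos (show 0 < b + 1 by linarith)
  have h3 := Real.Gamma_pos_of_pos (show 0 < k + a + 1 by linarith)
  have h4 := Real.Gamma_pos_of_pos (show 0 < k + b + 1 by linarith)
  have h5 := Real.Gamma_pos_of_pos (show 0 < a + b + 2 by linarith)
  have h6 := Real.Gamma_pos_of_pos (show 0 < k + a + b + 1 by linarith)
  have h7 : 0 < 2 * (k : ℝ) + a + b + 1 := by linarith
  have h8 : (0 : ℝ) < k.factorial := by positivity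
  positivity

lemma jacobiConst_pos (a b : ℝ) (ha : -1 < a) (hb : -1 < b) (k : ℕ) : 0 < jacobiConst a b k := by
  unfold jacobiConst
  split_ifs with hk
  · exact one_pos
  · exact Real.sqrt_pos.mpr (jacobiConst_sq a b ha hb k hk)

lemma jacobi_zero (a b y : ℝ) : jacobi a b 0 y = 1 := by
  simp [jacobi, jacobiConst, classicalJacobi]

lemma integral_jacobi_sq (a b : ℝ) (ha : -1 < a) (hb : -1 < b) (k : ℕ) :
    ∫ y : II, jacobi a b k y * jacobi a b k y ∂(jacobiMeasure a b) = 1 := by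
  rcases eq_or_ne k 0 with rfl | hk
  · have := isProbabilityMeasure_jacobiMeasure ha hb
    simp [jacobi_zero]
  have e : ∀ y : II, jacobi a b k y * jacobi a b k y = jacobiConst a b k ^ 2 *
      ((jacobiPoly a b k).eval ((1 + (y : ℝ)) / 2) *
        (jacobiPoly a b k).eval ((1 + (y : ℝ)) / 2)) := by
    intro y
    rw [jacobi, classicalJacobi_eq_eval]
    ring
  simp_rw [e]
  have hk1 : (1 : ℝ) ≤ k := by exact_mod_cast Nat.one_le_iff_ne_zero.mpr hk
  rw [integral_const_mul, integral_jacobiPoly_mul a b ha hb k _ (natDegree_jacobiPoly_le a b k),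
    coeff_jacobiPoly, jacobiConst, if_neg hk, Real.sq_sqrt (jacobiConst_sq a b ha hb k hk).le,
    ringChoose_eq_Gamma _ _ (by linarith),
    show a + b + 2 + k + k = (k + a + (k + b) + 1) + 1 by ring,
    Real.Gamma_add_one (by linarith : 0 < k + a + (k + b) + 1).ne',
    show k + a + (k + b) - k + 1 = k + a + b + 1 by ring]
  have h1 := (Real.Gamma_pos_of_pos (show 0 < a + 1 by linarith)).ne'
  have h2 := (Real.Gamma_pos_of_pos (show 0 < b + 1 by linarith)).ne'
  have h3 := (Real.Gamma_pos_of_pos (show 0 < k + a + 1 by linarith)).ne'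
  have h4 := (Real.Gamma_pos_of_pos (show 0 < k + b + 1 by linarith)).ne'
  have h5 := (Real.Gamma_pos_of_pos (show 0 < a + b + 2 by linarith)).ne'
  have h6 := (Real.Gamma_pos_of_pos (show 0 < k + a + b + 1 by linarith)).ne'
  have h7 := (Real.Gamma_pos_of_pos (show 0 < k + a + (k + b) + 1 by linarith)).ne'
  have h8 : (k.factorial : ℝ) ≠ 0 := by positivity
  have h9 : (k + a + (k + b) + 1 : ℝ) ≠ 0 := by linarith
  rw [show 2 * (k : ℝ) + a + b + 1 = k + a + (k + b) + 1 by ring]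
  field_simp

lemma integral_jacobi_mul_of_ne (a b : ℝ) (ha : -1 < a) (hb : -1 < b) {k l : ℕ} (h : k ≠ l) :
    ∫ y : II, jacobi a b k y * jacobi a b l y ∂(jacobiMeasure a b) = 0 := by
  wlog hkl : l < k generalizing k l
  · rw [← this h.symm (by omega)]
    simp_rw [mul_comm]
  have e : ∀ y : II, jacobi a b k y * jacobi a b l y = (jacobiConst a b k * jacobiConst a b l) *
      ((jacobiPoly a b k).eval ((1 + (y : ℝ)) / 2) *
        (jacobiPoly a b l).eval ((1 + (y : ℝ)) / 2)) := by
    intro y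
    rw [jacobi, jacobi, classicalJacobi_eq_eval, classicalJacobi_eq_eval]
    ring
  simp_rw [e]
  rw [integral_const_mul, integral_jacobiPoly_mul a b ha hb k _
    ((natDegree_jacobiPoly_le a b l).trans hkl.le),
    Polynomial.coeff_eq_zero_of_natDegree_lt ((natDegree_jacobiPoly_le a b l).trans_lt hkl)]
  simp

lemma integral_jacobi_mul (a b : ℝ) (ha : -1 < a) (hb : -1 < b) (k l : ℕ) :
    ∫ y : II, jacobi a b k y * jacobi a b l y ∂(jacobiMeasure a b) = if k = l then 1 else 0 := by
  split_ifs with h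
  · rw [h, integral_jacobi_sq a b ha hb]
  · exact integral_jacobi_mul_of_ne a b ha hb h

/-- The squared norm of `J_k` is a multiple of this coefficient, and it equals one. -/
lemma coeff_jacobiPoly_ne_zero (a b : ℝ) (ha : -1 < a) (hb : -1 < b) (k : ℕ) :
    (jacobiPoly a b k).coeff k ≠ 0 := by
  intro h0
  have h1 := integral_jacobi_sq a b ha hb k
  have e : ∀ y : II, jacobi a b k y * jacobi a b k y = jacobiConst a b k ^ 2 *
      ((jacobiPoly a b k).eval ((1 + (y : ℝ)) / 2) *
        (jacobiPoly a b k).eval ((1 + (y : ℝ)) / 2)) := by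
    intro y
    rw [jacobi, classicalJacobi_eq_eval]
    ring
  simp_rw [e] at h1
  rw [integral_const_mul, integral_jacobiPoly_mul a b ha hb k _ (natDegree_jacobiPoly_le a b k),
    h0] at h1
  simp at h1

/-- Every polynomial is a linear combination of Jacobi polynomials. -/
lemma exists_eval_eq_sum_jacobi (a b : ℝ) (ha : -1 < a) (hb : -1 < b) (k : ℕ) (Q : Polynomial ℝ)
    (hQ : Q.natDegree < k) :
    ∃ α : ℕ → ℝ, ∀ y : ℝ,
      Q.eval ((1 + y) / 2) = ∑ i ∈ Finset.range k, α i * jacobi a b i y := by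
  induction k generalizing Q with
  | zero => omega
  | succ k ih =>
    have hc := coeff_jacobiPoly_ne_zero a b ha hb k
    have hcc := (jacobiConst_pos a b ha hb k).ne'
    set t := Q.coeff k / (jacobiPoly a b k).coeff k with ht
    -- The zero alternative is indispensable for `k = 0`, where no `natDegree` is below `k`.
    have hR : (Q - Polynomial.C t * jacobiPoly a b k).natDegree < k ∨
        Q - Polynomial.C t * jacobiPoly a b k = 0 := by
      by_cases h0 : Q - Polynomial.C t * jacobiPoly a b k = 0
      · exact Or.inr h0
      left
      rw [Polynomial.natDegree_lt_iff_degree_lt h0, Polynomial.degree_lt_iff_coeff_zero]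
      intro m hm
      rcases hm.eq_or_lt with rfl | hm
      · simp [ht, hc]
      · rw [Polynomial.coeff_sub, Polynomial.coeff_C_mul,
          Polynomial.coeff_eq_zero_of_natDegree_lt (by omega),
          Polynomial.coeff_eq_zero_of_natDegree_lt ((natDegree_jacobiPoly_le a b k).trans_lt hm)]
        simp
    have hα : ∃ α : ℕ → ℝ, ∀ y : ℝ, (Q - Polynomial.C t * jacobiPoly a b k).eval ((1 + y) / 2) =
        ∑ i ∈ Finset.range k, α i * jacobi a b i y := by
      rcases hR with h | h
      · exact ih _ h
      · exact ⟨0, fun y => by simp [h]⟩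
    obtain ⟨α, hα⟩ := hα
    refine ⟨Function.update α k (t / jacobiConst a b k), fun y => ?_⟩
    have h1 := hα y
    rw [Finset.sum_range_succ, Function.update_self, jacobi, classicalJacobi_eq_eval]
    rw [Finset.sum_congr rfl fun i hi => by
      rw [Function.update_of_ne (Finset.mem_range.mp hi).ne], ← h1]
    simp only [Polynomial.eval_sub, Polynomial.eval_mul, Polynomial.eval_C]
    field_simp
    ring

/-! ### Truncation of abstract orthogonal expansions -/

section Hilbert

variable {H X S : Type*} [NormedAddCommGroup H] [InnerProductSpace ℝ H]
  [NormedAddCommGroup X] [InnerProductSpace ℝ X]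

open scoped InnerProductSpace in
/-- The remainder of a partial sum of an orthogonal expansion with dense span. -/
lemma norm_sub_partialSum_le [DecidableEq S] (T : S → X →ₗ[ℝ] H) (c : S → H →ₗ[ℝ] X)
    (hc : ∀ s x f, ⟪T s x, f⟫_ℝ = ⟪x, c s f⟫_ℝ)
    (hT : ∀ s t x, c s (T t x) = if s = t then x else 0)
    (hd : (⨆ s, LinearMap.range (T s)).topologicalClosure = ⊤)
    (f : H) (Λ : Finset S) {B : ℝ} (hB : 0 ≤ B)
    (h : ∀ F : Finset S, Disjoint F Λ → ∑ s ∈ F, ‖c s f‖ ^ 2 ≤ B ^ 2) :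
    ‖f - ∑ s ∈ Λ, T s (c s f)‖ ≤ B := by
  have hcs : ∀ (s : S) (G : Finset S) (x : S → X),
      c s (∑ t ∈ G, T t (x t)) = if s ∈ G then x s else 0 := by
    intro s G x
    rw [map_sum, Finset.sum_congr rfl fun t _ => hT s t (x t), Finset.sum_ite_eq]
  refine le_of_forall_pos_le_add fun ε hε => ?_
  have hf : f ∈ (⨆ s, LinearMap.range (T s)).topologicalClosure := by rw [hd]; trivial
  rw [← SetLike.mem_coe, Submodule.topologicalClosure_coe, Metric.mem_closure_iff] at hf
  obtain ⟨w, hw, hwε⟩ := hf ε hε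
  obtain ⟨g, hg, rfl⟩ := (Submodule.mem_iSup_iff_exists_finsupp _ _).mp hw
  choose x hx using hg
  set G := g.support ∪ Λ with hG
  have hw' : (g.sum fun _ z => z) = ∑ s ∈ G, T s (x s) := by
    rw [Finsupp.sum_of_support_subset g (s := G) Finset.subset_union_left _ (fun _ _ => rfl)]
    exact Finset.sum_congr rfl fun s _ => (hx s).symm
  -- `P` is the orthogonal projection of `f` onto the ranges indexed by `G`. It is at least as close
  -- to `f` as the approximant taken from the dense span, and it differs from the partial sum over
  -- `Λ` only by terms outside `Λ`. Only finite sets of coefficients occur, so no summability is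
  -- needed.
  set P := ∑ s ∈ G, T s (c s f) with hP
  have horth : ⟪P - ∑ s ∈ G, T s (x s), f - P⟫_ℝ = 0 := by
    rw [hP, ← Finset.sum_sub_distrib, sum_inner]
    refine Finset.sum_eq_zero fun s hs => ?_
    rw [← map_sub, hc, map_sub, hcs, if_pos hs, sub_self, inner_zero_right]
  have h1 : ‖f - P‖ ≤ ε := by
    rw [dist_eq_norm, hw', show f - ∑ s ∈ G, T s (x s) = (P - ∑ s ∈ G, T s (x s)) + (f - P) by
      abel] at hwε
    have := norm_add_sq_real (P - ∑ s ∈ G, T s (x s)) (f - P)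
    rw [horth] at this
    refine le_trans ?_ hwε.le
    refine le_of_sq_le_sq ?_ (norm_nonneg _)
    nlinarith [sq_nonneg ‖P - ∑ s ∈ G, T s (x s)‖]
  have h2 : ‖P - ∑ s ∈ Λ, T s (c s f)‖ ≤ B := by
    refine le_of_sq_le_sq ?_ hB
    have e : P - ∑ s ∈ Λ, T s (c s f) = ∑ s ∈ G \ Λ, T s (c s f) := by
      rw [hP, ← Finset.sum_sdiff (Finset.subset_union_right : Λ ⊆ G)]
      abel
    rw [e, ← real_inner_self_eq_norm_sq, sum_inner]
    refine le_trans (le_of_eq ?_) (h (G \ Λ) Finset.sdiff_disjoint)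
    refine Finset.sum_congr rfl fun s hs => ?_
    rw [hc, hcs, if_pos hs, real_inner_self_eq_norm_sq]
  calc ‖f - ∑ s ∈ Λ, T s (c s f)‖ = ‖(f - P) + (P - ∑ s ∈ Λ, T s (c s f))‖ := by congr 1; abel
    _ ≤ ‖f - P‖ + ‖P - ∑ s ∈ Λ, T s (c s f)‖ := norm_add_le _ _
    _ ≤ B + ε := by linarith

end Hilbert

/-! ### The tensor product system on the infinite cube -/

lemma prod_sum_eq_sum_piFinset {R : Type*} [CommSemiring R] (S : Finset ℕ) (t : ℕ → Finset ℕ)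
    (f : ℕ → ℕ → R) :
    ∏ j ∈ S, ∑ i ∈ t j, f j i =
      ∑ p ∈ Fintype.piFinset (fun x : S => t x), ∏ x : S, f x (p x) := by
  rw [← Finset.prod_coe_sort, Finset.prod_univ_sum]

instance : CompactSpace II := isCompact_iff_compactSpace.mp isCompact_Icc

@[fun_prop]
lemma continuous_jacobi (a b : ℝ) (k : ℕ) : Continuous (jacobi a b k) := by
  unfold jacobi classicalJacobi; fun_prop

@[fun_prop]
lemma continuous_jacobiTensor (a b : ℝ) (s : ℕ →₀ ℕ) : Continuous (jacobiTensor a b s) := by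
  unfold jacobiTensor; fun_prop

lemma jacobiTensor_eq_prod (a b : ℝ) (s : ℕ →₀ ℕ) (S : Finset ℕ) (hS : s.support ⊆ S)
    (y : ℕ → II) : jacobiTensor a b s y = ∏ j ∈ S, jacobi a b (s j) (y j) := by
  refine Finset.prod_subset hS fun j _ hj => ?_
  rw [Finsupp.notMem_support_iff.mp hj, jacobi_zero]

lemma isProbabilityMeasure_jacobiProductMeasure {a b : ℝ} (ha : -1 < a) (hb : -1 < b) :
    IsProbabilityMeasure (jacobiProductMeasure a b) := by
  have := isProbabilityMeasure_jacobiMeasure ha hb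
  unfold jacobiProductMeasure
  infer_instance

/-- The coordinates are independent under the product measure, so the expectation of the product
factorizes. -/
lemma integral_prod_jacobiProductMeasure {a b : ℝ} (ha : -1 < a) (hb : -1 < b) (S : Finset ℕ)
    (f : ℕ → II → ℝ) (hf : ∀ j, Continuous (f j)) :
    ∫ y, ∏ j ∈ S, f j (y j) ∂(jacobiProductMeasure a b) =
      ∏ j ∈ S, ∫ t, f j t ∂(jacobiMeasure a b) := by
  have := isProbabilityMeasure_jacobiMeasure ha hb
  have hind := (iIndepFun_infinitePi (P := fun _ : ℕ => jacobiMeasure a b) (X := f)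
    (fun j => (hf j).measurable)).precomp (Subtype.val_injective (p := fun j => j ∈ S))
  have hi := hind.integral_fun_prod_eq_prod_integral
    (fun j => ((hf j).measurable.comp (measurable_pi_apply (j : ℕ))).aestronglyMeasurable)
  have e1 : ∀ y : ℕ → II, ∏ j ∈ S, f j (y j) = ∏ x : S, f x (y x) := fun y =>
    (Finset.prod_coe_sort S fun j => f j (y j)).symm
  simp_rw [e1]
  rw [← Finset.prod_coe_sort, jacobiProductMeasure]
  refine hi.trans (Finset.prod_congr rfl fun x _ => ?_)
  exact (measurePreserving_eval_infinitePi (fun _ : ℕ => jacobiMeasure a b) x).hasLaw.integral_comp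
    (hf x).aestronglyMeasurable

lemma integral_jacobiTensor_mul {a b : ℝ} (ha : -1 < a) (hb : -1 < b) (s t : ℕ →₀ ℕ) :
    ∫ y, jacobiTensor a b s y * jacobiTensor a b t y ∂(jacobiProductMeasure a b) =
      if s = t then 1 else 0 := by
  have e : ∀ y : ℕ → II, jacobiTensor a b s y * jacobiTensor a b t y =
      ∏ j ∈ s.support ∪ t.support,
        (fun (j : ℕ) (z : II) => jacobi a b (s j) z * jacobi a b (t j) z) j (y j) := by
    intro y
    rw [jacobiTensor_eq_prod a b s _ Finset.subset_union_left,
      jacobiTensor_eq_prod a b t _ Finset.subset_union_right, ← Finset.prod_mul_distrib]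
  rw [integral_congr_ae (Filter.Eventually.of_forall e),
    integral_prod_jacobiProductMeasure ha hb _
      (fun (j : ℕ) (z : II) => jacobi a b (s j) z * jacobi a b (t j) z) fun j => by fun_prop]
  simp_rw [integral_jacobi_mul a b ha hb]
  split_ifs with h
  · subst h
    simp
  · obtain ⟨j, hj⟩ := Finsupp.ne_iff.mp h
    refine Finset.prod_eq_zero (i := j) ?_ (if_neg hj)
    rw [Finset.mem_union, Finsupp.mem_support_iff, Finsupp.mem_support_iff]
    by_contra hcon
    push Not at hcon
    exact hj (hcon.1.trans hcon.2.symm)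

/-- The tensor product polynomial as a continuous function. -/
def jacobiTensorC (a b : ℝ) (s : ℕ →₀ ℕ) : C(ℕ → II, ℝ) :=
  ⟨jacobiTensor a b s, continuous_jacobiTensor a b s⟩

/-- The coordinate `(1 + y_j) / 2` as a continuous function. -/
def unitCoord (j : ℕ) : C(ℕ → II, ℝ) := ⟨fun y => (1 + (y j : ℝ)) / 2, by fun_prop⟩

/-- By triangularity each power `u_j^(e_j)` is a combination of `J_0, …, J_{e_j}`; multiplying these
finite sums out yields tensor polynomials. -/
lemma monomial_mem_span (a b : ℝ) (ha : -1 < a) (hb : -1 < b) (e : ℕ →₀ ℕ) :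
    ∏ j ∈ e.support, unitCoord j ^ e j ∈ Submodule.span ℝ (Set.range (jacobiTensorC a b)) := by
  have h := fun j => exists_eval_eq_sum_jacobi a b ha hb (e j + 1) (Polynomial.X ^ e j) (by simp)
  choose α hα using h
  have key : (∏ j ∈ e.support, unitCoord j ^ e j : C(ℕ → II, ℝ)) =
      ∑ p ∈ Fintype.piFinset (fun x : e.support => Finset.range (e x + 1)),
        (∏ x : e.support, α x (p x)) • jacobiTensorC a b (Finsupp.onFinset e.support
          (fun j => if hj : j ∈ e.support then p ⟨j, hj⟩ else 0)
          (fun j hj => by by_contra hcon; simp [hcon] at hj)) := by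
    ext y
    rw [ContinuousMap.coe_prod, Finset.prod_apply, ContinuousMap.coe_sum, Finset.sum_apply]
    have e1 : ∀ j, (unitCoord j ^ e j) y =
        ∑ i ∈ Finset.range (e j + 1), α j i * jacobi a b i (y j) := by
      intro j
      rw [← hα j]
      simp [unitCoord]
    simp_rw [e1]
    rw [prod_sum_eq_sum_piFinset e.support (fun j => Finset.range (e j + 1))
      (fun j i => α j i * jacobi a b i (y j))]
    refine Finset.sum_congr rfl fun p _ => ?_
    rw [Finset.prod_mul_distrib, ContinuousMap.smul_apply, smul_eq_mul]
    congr 1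
    change _ = jacobiTensor a b _ y
    rw [jacobiTensor_eq_prod a b _ e.support Finsupp.support_onFinset_subset]
    refine Eq.trans (Finset.prod_congr rfl fun x _ => ?_) (Finset.prod_coe_sort e.support _)
    rw [Finsupp.onFinset_apply, dif_pos x.2]
  rw [key]
  exact Submodule.sum_mem _ fun p _ => Submodule.smul_mem _ _ (Submodule.subset_span ⟨_, rfl⟩)

/-- Stone–Weierstrass on the compact cube: the coordinates separate points, and the algebra that
they generate is spanned by monomials. -/
lemma span_jacobiTensorC_closure (a b : ℝ) (ha : -1 < a) (hb : -1 < b) :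
    (Submodule.span ℝ (Set.range (jacobiTensorC a b))).topologicalClosure = ⊤ := by
  have hA := ContinuousMap.subalgebra_topologicalClosure_eq_top_of_separatesPoints
    (Algebra.adjoin ℝ (Set.range unitCoord)) (by
      intro y z hyz
      obtain ⟨j, hj⟩ := Function.ne_iff.mp hyz
      refine ⟨_, ⟨unitCoord j, Algebra.subset_adjoin ⟨j, rfl⟩, rfl⟩, fun h => hj ?_⟩
      simp only [unitCoord, ContinuousMap.coe_mk] at h
      exact Subtype.ext (by linarith))
  have hle : Subalgebra.toSubmodule (Algebra.adjoin ℝ (Set.range unitCoord)) ≤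
      Submodule.span ℝ (Set.range (jacobiTensorC a b)) := by
    intro g hg
    rw [Subalgebra.mem_toSubmodule, Algebra.adjoin_range_eq_range_aeval] at hg
    obtain ⟨p, rfl⟩ := hg
    change MvPolynomial.aeval unitCoord p ∈ _
    rw [MvPolynomial.aeval_def, MvPolynomial.eval₂_eq]
    refine Submodule.sum_mem _ fun e _ => ?_
    rw [← Algebra.smul_def]
    exact Submodule.smul_mem _ _ (monomial_mem_span a b ha hb e)
  rw [eq_top_iff]
  intro g _
  have hg : g ∈ (Algebra.adjoin ℝ (Set.range unitCoord)).topologicalClosure := by rw [hA]; trivial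
  rw [← SetLike.mem_coe, Subalgebra.topologicalClosure_coe] at hg
  rw [← SetLike.mem_coe, Submodule.topologicalClosure_coe]
  exact closure_mono hle hg

/-! ### The expansion of vector-valued functions -/

section Bochner

variable {X : Type*} [NormedAddCommGroup X] [InnerProductSpace ℝ X]

/-- The tensor product polynomial as an element of `L_2`. -/
def jacobiTensorLp (a b : ℝ) [IsFiniteMeasure (jacobiProductMeasure a b)] (s : ℕ →₀ ℕ) :
    Lp ℝ 2 (jacobiProductMeasure a b) :=
  ContinuousMap.toLp 2 (jacobiProductMeasure a b) ℝ (jacobiTensorC a b s)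

lemma span_jacobiTensorLp_closure (a b : ℝ) (ha : -1 < a) (hb : -1 < b)
    [IsFiniteMeasure (jacobiProductMeasure a b)] :
    (Submodule.span ℝ (Set.range (jacobiTensorLp a b))).topologicalClosure = ⊤ := by
  have h := (ContinuousMap.toLp_denseRange ℝ (jacobiProductMeasure a b) ℝ
    (p := 2) (by simp)).topologicalClosure_map_submodule (span_jacobiTensorC_closure a b ha hb)
  simpa only [Submodule.map_span, ContinuousLinearMap.coe_coe, ← Set.range_comp,
    Function.comp_def] using! h

/-- The map `(x, f) ↦ f x` from `X × L_2(ℝ)` to `L_2(X)`. -/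
def lpSmulRight (X : Type*) [NormedAddCommGroup X] [InnerProductSpace ℝ X] (a b : ℝ) :
    X →L[ℝ] Lp ℝ 2 (jacobiProductMeasure a b) →L[ℝ] Lp X 2 (jacobiProductMeasure a b) :=
  ContinuousLinearMap.compLpL₂ 2 (jacobiProductMeasure a b)
    (ContinuousLinearMap.lsmul ℝ ℝ : ℝ →L[ℝ] X →L[ℝ] X).flip

lemma coeFn_lpSmulRight (a b : ℝ) (x : X) (f : Lp ℝ 2 (jacobiProductMeasure a b)) :
    lpSmulRight X a b x f =ᵐ[jacobiProductMeasure a b] fun y => f y • x := by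
  rw [lpSmulRight, ContinuousLinearMap.compLpL₂_apply_apply]
  exact ContinuousLinearMap.coeFn_compLp _ f

/-- For fixed `x`, the set of scalar `f` with `f x` in the closure is closed and contains the `J_s`,
so by scalar completeness it is all of `L_2`. In particular it contains indicators, and indicators
times vectors generate `L_2(X)`. -/
lemma iSup_range_lpSmulRight_closure (a b : ℝ) (ha : -1 < a) (hb : -1 < b)
    [IsFiniteMeasure (jacobiProductMeasure a b)] :
    (⨆ s, LinearMap.range ((lpSmulRight X a b).flip (jacobiTensorLp a b s) :
      X →ₗ[ℝ] Lp X 2 (jacobiProductMeasure a b))).topologicalClosure = ⊤ := by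
  set V := ⨆ s, LinearMap.range ((lpSmulRight X a b).flip (jacobiTensorLp a b s) :
      X →ₗ[ℝ] Lp X 2 (jacobiProductMeasure a b)) with hV
  have hmem : ∀ (x : X) (f : Lp ℝ 2 (jacobiProductMeasure a b)),
      lpSmulRight X a b x f ∈ V.topologicalClosure := by
    intro x f
    have hle : (Submodule.span ℝ (Set.range (jacobiTensorLp a b))).topologicalClosure ≤
        V.topologicalClosure.comap (lpSmulRight X a b x).toLinearMap := by
      refine Submodule.topologicalClosure_minimal _ ?_ ?_
      · rw [Submodule.span_le]
        rintro _ ⟨s, rfl⟩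
        exact V.le_topologicalClosure (Submodule.mem_iSup_of_mem s ⟨x, rfl⟩)
      · exact V.isClosed_topologicalClosure.preimage (lpSmulRight X a b x).continuous
    rw [span_jacobiTensorLp_closure a b ha hb] at hle
    exact hle trivial
  rw [eq_top_iff]
  intro f _
  refine Lp.induction (by simp) (motive := fun f => f ∈ V.topologicalClosure) ?_ ?_ ?_ f
  · intro c A hA hμ
    convert hmem c (indicatorConstLp 2 hA hμ.ne 1) using 1
    rw [Lp.simpleFunc.coe_indicatorConst]
    refine Lp.ext ?_
    refine indicatorConstLp_coeFn.trans ?_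
    filter_upwards [coeFn_lpSmulRight a b c (indicatorConstLp 2 hA hμ.ne (1 : ℝ)),
      indicatorConstLp_coeFn (p := 2) (hs := hA) (hμs := hμ.ne) (c := (1 : ℝ))] with y h1 h2
    rw [h1, h2]
    by_cases hy : y ∈ A <;> simp [hy]
  · intro f g hf hg _ h1 h2
    exact Submodule.add_mem _ h1 h2
  · exact V.isClosed_topologicalClosure

lemma integrable_jacobiTensor_smul {a b : ℝ} (ha : -1 < a) (hb : -1 < b) (s : ℕ →₀ ℕ)
    {v : (ℕ → II) → X} (hv : MemLp v 2 (jacobiProductMeasure a b)) :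
    Integrable (fun y => jacobiTensor a b s y • v y) (jacobiProductMeasure a b) := by
  have := isProbabilityMeasure_jacobiProductMeasure ha hb
  refine (hv.integrable (by norm_num)).bdd_smul ‖jacobiTensorC a b s‖
    (continuous_jacobiTensor a b s).aestronglyMeasurable ?_
  exact Filter.Eventually.of_forall fun y => (jacobiTensorC a b s).norm_coe_le_norm y

variable [CompleteSpace X]

/-- The gpc coefficient as a linear map on `L_2`. -/
def gpcCoeffₗ {a b : ℝ} (ha : -1 < a) (hb : -1 < b) (s : ℕ →₀ ℕ) :
    Lp X 2 (jacobiProductMeasure a b) →ₗ[ℝ] X where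
  toFun f := gpcCoeff a b f s
  map_add' f g := by
    rw [gpcCoeff, gpcCoeff, gpcCoeff, ← integral_add
      (integrable_jacobiTensor_smul ha hb s (Lp.memLp f))
      (integrable_jacobiTensor_smul ha hb s (Lp.memLp g))]
    refine integral_congr_ae ?_
    filter_upwards [Lp.coeFn_add f g] with y hy
    rw [hy, Pi.add_apply, smul_add]
  map_smul' r f := by
    rw [gpcCoeff, gpcCoeff, RingHom.id_apply, ← integral_smul]
    refine integral_congr_ae ?_
    filter_upwards [Lp.coeFn_smul r f] with y hy
    rw [hy, Pi.smul_apply, smul_comm]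

/-- The truncation error of the gpc expansion is controlled by the remaining coefficients. -/
theorem eLpNorm_sub_gpc_partialSum_le {a b : ℝ} (ha : -1 < a) (hb : -1 < b)
    {v : (ℕ → II) → X} (hv : MemLp v 2 (jacobiProductMeasure a b)) (Λ : Finset (ℕ →₀ ℕ))
    {B : ℝ} (hB : 0 ≤ B)
    (h : ∀ F : Finset (ℕ →₀ ℕ), Disjoint F Λ → ∑ s ∈ F, ‖gpcCoeff a b v s‖ ^ 2 ≤ B ^ 2) :
    eLpNorm (fun y => v y - ∑ s ∈ Λ, jacobiTensor a b s y • gpcCoeff a b v s) 2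
      (jacobiProductMeasure a b) ≤ ENNReal.ofReal B := by
  have := isProbabilityMeasure_jacobiProductMeasure ha hb
  have hcoef : ∀ s, gpcCoeff a b (hv.toLp v) s = gpcCoeff a b v s := fun s =>
    integral_congr_ae (hv.coeFn_toLp.mono fun y hy => by simp only [hy])
  have hTy : ∀ s (x : X), (lpSmulRight X a b).flip (jacobiTensorLp a b s) x
      =ᵐ[jacobiProductMeasure a b] fun y => jacobiTensor a b s y • x := by
    intro s x
    filter_upwards [coeFn_lpSmulRight a b x (jacobiTensorLp a b s),
      ContinuousMap.coeFn_toLp (p := 2) (𝕜 := ℝ) (jacobiProductMeasure a b)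
        (jacobiTensorC a b s)] with y h1 h2
    rw [ContinuousLinearMap.flip_apply, h1, jacobiTensorLp, h2]
    rfl
  -- Here `T s x` is the function `J_s x`. The three goals left open are adjointness to the
  -- coefficient map, biorthogonality, and the bound on the coefficients outside `Λ`.
  have key := norm_sub_partialSum_le
    (fun s => ((lpSmulRight X a b).flip (jacobiTensorLp a b s)).toLinearMap)
    (gpcCoeffₗ (X := X) ha hb) ?_ ?_ (iSup_range_lpSmulRight_closure a b ha hb) (hv.toLp v) Λ hB ?_
  · rw [Lp.norm_def] at key
    have key' := ENNReal.ofReal_le_ofReal key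
    rw [ENNReal.ofReal_toReal (Lp.eLpNorm_ne_top _)] at key'
    refine le_trans (le_of_eq (eLpNorm_congr_ae ?_)) key'
    have hsum : ∀ᵐ y ∂(jacobiProductMeasure a b), ∀ s ∈ Λ,
        (lpSmulRight X a b).flip (jacobiTensorLp a b s) (gpcCoeff a b v s) y =
          jacobiTensor a b s y • gpcCoeff a b v s :=
      (ae_ball_iff Λ.countable_toSet).mpr fun s _ => hTy s _
    filter_upwards [Lp.coeFn_sub (hv.toLp v) (∑ s ∈ Λ, (lpSmulRight X a b).flip
      (jacobiTensorLp a b s) (gpcCoeff a b v s)), hv.coeFn_toLp, hsum,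
      Lp.coeFn_finsetSum Λ fun s => (lpSmulRight X a b).flip
      (jacobiTensorLp a b s) (gpcCoeff a b v s)] with y h1 h2 h3 h4
    have : ∀ s, gpcCoeffₗ ha hb s (hv.toLp v) = gpcCoeff a b v s := hcoef
    simp only [this]
    refine Eq.trans ?_ h1.symm
    rw [Pi.sub_apply, h2, h4, Finset.sum_apply, Finset.sum_congr rfl h3]
  · intro s x f
    rw [L2.inner_def]
    change _ = inner ℝ x (gpcCoeff a b f s)
    rw [gpcCoeff, ← integral_inner (integrable_jacobiTensor_smul ha hb s (Lp.memLp f))]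
    refine integral_congr_ae ?_
    filter_upwards [hTy s x] with y hy
    change inner ℝ ((lpSmulRight X a b).flip (jacobiTensorLp a b s) x y) (f y) = _
    rw [hy, real_inner_smul_left, real_inner_smul_right]
  · intro s t x
    change gpcCoeff a b ((lpSmulRight X a b).flip (jacobiTensorLp a b t) x) s = _
    have : gpcCoeff a b ((lpSmulRight X a b).flip (jacobiTensorLp a b t) x) s =
        ∫ y, (jacobiTensor a b s y * jacobiTensor a b t y) • x ∂(jacobiProductMeasure a b) := by
      refine integral_congr_ae ?_
      filter_upwards [hTy t x] with y hy
      rw [hy, smul_smul]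
    rw [this, integral_smul_const, integral_jacobiTensor_mul ha hb]
    split_ifs <;> simp
  · intro F hF
    have : ∀ s, gpcCoeffₗ ha hb s (hv.toLp v) = gpcCoeff a b v s := hcoef
    simp only [this]
    exact h F hF

end Bochner

/-! ## Networks with one neuron per layer -/

section Chains

variable {E : Type*}

/-- `AffineIn m x zs c f`: the function `f` is an affine combination of the inputs `x k`, `k < m`,
and of the functions in `zs` which uses at most `c` nonzero coefficients. -/
inductive AffineIn (m : ℕ) (x : ℕ → E → ℝ) (zs : List (E → ℝ)) : ℕ → (E → ℝ) → Prop
  | zero : AffineIn m x zs 0 fun _ => 0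
  | input {c f} (r : ℝ) (k : ℕ) (hk : k < m) (hf : AffineIn m x zs c f) :
      AffineIn m x zs (c + 1) fun y => f y + r * x k y
  | neuron {c f} (r : ℝ) (g : E → ℝ) (hg : g ∈ zs) (hf : AffineIn m x zs c f) :
      AffineIn m x zs (c + 1) fun y => f y + r * g y
  | const {c f} (r : ℝ) (hf : AffineIn m x zs c f) :
      AffineIn m x zs (c + 1) fun y => f y + r

/-- `Chain m x zs c`: the functions in `zs` are the successive neurons, the last one first, of a
network with one neuron per layer and at most `c` nonzero weights and biases. -/
inductive Chain (m : ℕ) (x : ℕ → E → ℝ) : List (E → ℝ) → ℕ → Prop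
  | nil : Chain m x [] 0
  | cons {zs c d f} (h : Chain m x zs c) (hf : AffineIn m x zs d f) :
      Chain m x ((fun y => max (f y) 0) :: zs) (c + d)

variable {m : ℕ} {x : ℕ → E → ℝ} {zs zs' : List (E → ℝ)} {c d : ℕ} {f g : E → ℝ}

lemma AffineIn.congr (h : AffineIn m x zs c f) (hfg : ∀ y, f y = g y) : AffineIn m x zs c g := by
  rwa [← show f = g from funext hfg]

lemma AffineIn.mono (h : AffineIn m x zs c f) (hz : zs ⊆ zs') : AffineIn m x zs' c f := by
  induction h with
  | zero => exact .zero
  | input r k hk _ ih => exact ih.input r k hk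
  | neuron r g hg _ ih => exact ih.neuron r g (hz hg)
  | const r _ ih => exact ih.const r

lemma AffineIn.smul (h : AffineIn m x zs c f) (s : ℝ) :
    AffineIn m x zs c fun y => s * f y := by
  induction h with
  | zero => exact AffineIn.zero.congr fun y => by simp
  | input r k hk _ ih => exact (ih.input (s * r) k hk).congr fun y => by ring
  | neuron r g hg _ ih => exact (ih.neuron (s * r) g hg).congr fun y => by ring
  | const r _ ih => exact (ih.const (s * r)).congr fun y => by ring

lemma AffineIn.add (h : AffineIn m x zs c f) (h' : AffineIn m x zs d g) :
    AffineIn m x zs (c + d) fun y => f y + g y := by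
  induction h' with
  | zero => exact h.congr fun y => by simp
  | input r k hk _ ih => exact (ih.input r k hk).congr fun y => by ring
  | neuron r g hg _ ih => exact (ih.neuron r g hg).congr fun y => by ring
  | const r _ ih => exact (ih.const r).congr fun y => by ring

lemma AffineIn.single (hg : g ∈ zs) (r : ℝ) : AffineIn m x zs 1 fun y => r * g y :=
  (AffineIn.zero.neuron r g hg).congr fun y => by simp

/-- The activation is the identity on nonnegative functions, so a neuron can store such a
combination unchanged. -/
lemma Chain.cons_of_nonneg (h : Chain m x zs c) (hf : AffineIn m x zs d f) (h0 : ∀ y, 0 ≤ f y) :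
    Chain m x (f :: zs) (c + d) := by
  have := h.cons hf
  rwa [show (fun y => max (f y) 0) = f from funext fun y => max_eq_left (h0 y)] at this

/-! ### Squaring -/

/-- The tooth function on `[0,1]`. -/
def tooth (u : ℝ) : ℝ := 2 * u - max (4 * u - 2) 0

lemma tooth_mem {u : ℝ} (hu : u ∈ Set.Icc (0 : ℝ) 1) : tooth u ∈ Set.Icc (0 : ℝ) 1 := by
  unfold tooth
  obtain ⟨h0, h1⟩ := hu
  rcases max_cases (4 * u - 2) 0 with h | h <;> constructor <;> linarith

lemma tooth_iterate_mem {u : ℝ} (hu : u ∈ Set.Icc (0 : ℝ) 1) (i : ℕ) :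
    tooth^[i] u ∈ Set.Icc (0 : ℝ) 1 := by
  induction i with
  | zero => simpa using hu
  | succ i ih => rw [Function.iterate_succ_apply']; exact tooth_mem ih

/-- Self-similarity of the parabola: iteration yields `u - u^2 = ∑ 4^(-i) tooth^[i] u` on `[0,1]`,
the series truncated in `approxSq`. -/
lemma sub_sq_eq_tooth (u : ℝ) : u - u ^ 2 = (tooth u + (tooth u - tooth u ^ 2)) / 4 := by
  unfold tooth
  rcases max_cases (4 * u - 2) 0 with h | h <;> rw [h.1] <;> ring

/-- The piecewise linear interpolation of `u ↦ u ^ 2` on a dyadic grid. -/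
def approxSq (K : ℕ) (u : ℝ) : ℝ :=
  u - ∑ i ∈ Finset.range K, (1 / 4 : ℝ) ^ (i + 1) * tooth^[i + 1] u

/-- By `sub_sq_eq_tooth` the error of level `K + 1` at `u` is a quarter of the error of level `K` at
`tooth u`. The start is `0 ≤ u - u^2 ≤ 1/4`. -/
lemma approxSq_mem (K : ℕ) {u : ℝ} (hu : u ∈ Set.Icc (0 : ℝ) 1) :
    approxSq K u ∈ Set.Icc (u ^ 2) (u ^ 2 + (1 / 4 : ℝ) ^ (K + 1)) := by
  induction K generalizing u with
  | zero =>
    obtain ⟨h0, h1⟩ := hu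
    simp only [approxSq, Finset.range_zero, Finset.sum_empty, sub_zero, zero_add, pow_one]
    constructor <;> nlinarith [sq_nonneg (u - 1 / 2)]
  | succ K ih =>
    have h := ih (tooth_mem hu)
    have e : approxSq (K + 1) u - u ^ 2 = (approxSq K (tooth u) - tooth u ^ 2) / 4 := by
      have h4 := sub_sq_eq_tooth u
      have h5 : ∑ i ∈ Finset.range K, (1 / 4 : ℝ) ^ (i + 1 + 1) * tooth^[i + 1 + 1] u =
          1 / 4 * ∑ i ∈ Finset.range K, (1 / 4 : ℝ) ^ (i + 1) * tooth^[i + 1] (tooth u) := by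
        rw [Finset.mul_sum]
        refine Finset.sum_congr rfl fun i _ => ?_
        rw [Function.iterate_succ_apply tooth (i + 1), pow_succ (1 / 4 : ℝ) (i + 1)]
        ring
      simp only [approxSq]
      rw [Finset.sum_range_succ', h5]
      simp only [zero_add, pow_one, Function.iterate_one]
      linarith
    obtain ⟨h1, h2⟩ := h
    rw [pow_succ (1 / 4 : ℝ) (K + 1)]
    constructor <;> linarith

/-- Each iteration takes two neurons with two coefficients each: the kink `max (4g - 2) 0`, and `2g`
minus the kink. Later neurons see all earlier ones, so the iterates need not be carried along. -/
lemma Chain.exists_tooth (h : Chain m x zs c) (hg : g ∈ zs)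
    (hg1 : ∀ y, g y ∈ Set.Icc (0 : ℝ) 1) (K : ℕ) :
    ∃ zs', Chain m x zs' (c + 4 * K) ∧ zs'.length = zs.length + 2 * K ∧ zs ⊆ zs' ∧
      ∀ i ≤ K, (fun y => tooth^[i] (g y)) ∈ zs' := by
  induction K with
  | zero =>
    refine ⟨zs, h, rfl, fun _ => id, fun i hi => ?_⟩
    obtain rfl : i = 0 := by omega
    exact hg
  | succ K ih =>
    obtain ⟨zs', h1, h2, h3, h4⟩ := ih
    have hB := h1.cons ((AffineIn.single (h4 K le_rfl) 4).const (-2))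
    set B : E → ℝ := fun y => max (4 * tooth^[K] (g y) + -2) 0 with hBdef
    have hA : AffineIn m x (B :: zs') 2 fun y => tooth^[K + 1] (g y) :=
      ((AffineIn.single (List.mem_cons_of_mem _ (h4 K le_rfl)) 2).add
        (AffineIn.single List.mem_cons_self (-1))).congr fun y => by
        rw [Function.iterate_succ_apply', tooth, hBdef]
        simp only [← sub_eq_add_neg]
        ring
    refine ⟨_, hB.cons_of_nonneg hA fun y => (tooth_iterate_mem (hg1 y) _).1, ?_, ?_, ?_⟩
    · simp only [List.length_cons, h2]; ring
    · exact fun z hz => List.mem_cons_of_mem _ (List.mem_cons_of_mem _ (h3 hz))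
    · intro i hi
      rcases hi.eq_or_lt with rfl | hi
      · exact List.mem_cons_self
      · exact List.mem_cons_of_mem _ (List.mem_cons_of_mem _ (h4 i (by omega)))

lemma AffineIn.approxSq {K : ℕ} (hg : ∀ i ≤ K, (fun y => tooth^[i] (g y)) ∈ zs) :
    AffineIn m x zs (1 + K) fun y => approxSq K (g y) := by
  have hs : ∀ L ≤ K, AffineIn m x zs L
      fun y => ∑ i ∈ Finset.range L, (1 / 4 : ℝ) ^ (i + 1) * tooth^[i + 1] (g y) := by
    intro L hL
    induction L with
    | zero => exact AffineIn.zero.congr fun y => by simp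
    | succ L ih =>
      exact ((ih (by omega)).neuron ((1 / 4 : ℝ) ^ (L + 1)) _ (hg (L + 1) hL)).congr fun y => by
        rw [Finset.sum_range_succ]
  exact ((AffineIn.single (hg 0 (Nat.zero_le _)) 1).add ((hs K le_rfl).smul (-1))).congr
    fun y => by simp [JacobiReLU.approxSq, sub_eq_add_neg]

/-! ### Products -/

/-- With `A = (p+t)/2` and `F = |p-t|/2`, both in `[0,1]`, one has `p t = A^2 - F^2`. The absolute
value is the sum of two rectified differences. The neurons `A, D, D', F` use `3 + 3 + 3 + 2`
coefficients, the tooth functions `8K`, the last neuron `2K + 3`. -/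
lemma Chain.exists_mul (h : Chain m x zs c) {p t : E → ℝ} (hp : p ∈ zs)
    (hp1 : ∀ y, p y ∈ Set.Icc (0 : ℝ) 1) (ht : AffineIn m x [] 2 t)
    (ht1 : ∀ y, t y ∈ Set.Icc (0 : ℝ) 1) (K : ℕ) :
    ∃ zs', Chain m x zs' (c + (10 * K + 14)) ∧ zs'.length = zs.length + (4 * K + 5) ∧
      ∃ p' ∈ zs', ∀ y, p' y ∈ Set.Icc (0 : ℝ) 1 ∧ |p' y - p y * t y| ≤ (1 / 4 : ℝ) ^ K := by
  set A : E → ℝ := fun y => 1 / 2 * p y + 1 / 2 * t y with hA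
  set D : E → ℝ := fun y => max (1 * p y + -1 * t y) 0 with hD
  set D' : E → ℝ := fun y => max (-1 * p y + t y) 0 with hD'
  set F : E → ℝ := fun y => 1 / 2 * D y + 1 / 2 * D' y with hF
  have hF' : ∀ y, F y = |p y - t y| / 2 := by
    intro y
    simp only [hF, hD, hD']
    rcases le_total (p y) (t y) with h | h
    · rw [max_eq_right (by linarith), max_eq_left (by linarith), abs_of_nonpos (by linarith)]
      ring
    · rw [max_eq_left (by linarith), max_eq_right (by linarith), abs_of_nonneg (by linarith)]
      ring
  have hA1 : ∀ y, A y ∈ Set.Icc (0 : ℝ) 1 := fun y => by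
    obtain ⟨h1, h2⟩ := hp1 y
    obtain ⟨h3, h4⟩ := ht1 y
    constructor <;> simp only [hA] <;> linarith
  have hF1 : ∀ y, F y ∈ Set.Icc (0 : ℝ) 1 := fun y => by
    obtain ⟨h1, h2⟩ := hp1 y
    obtain ⟨h3, h4⟩ := ht1 y
    rw [hF']
    have : |p y - t y| ≤ 1 := abs_le.mpr ⟨by linarith, by linarith⟩
    constructor
    · positivity
    · linarith
  have htz : ∀ zs : List (E → ℝ), AffineIn m x zs 2 t := fun zs => ht.mono (List.nil_subset _)
  have c1 : Chain m x (A :: zs) (c + (1 + 2)) :=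
    h.cons_of_nonneg ((AffineIn.single hp (1 / 2)).add ((htz zs).smul (1 / 2))) fun y => (hA1 y).1
  have hp2 : p ∈ A :: zs := List.mem_cons_of_mem _ hp
  have c2 : Chain m x (D :: A :: zs) _ :=
    c1.cons ((AffineIn.single hp2 1).add ((htz _).smul (-1)))
  have hp3 : p ∈ D :: A :: zs := List.mem_cons_of_mem _ hp2
  have c3 : Chain m x (D' :: D :: A :: zs) _ := c2.cons ((AffineIn.single hp3 (-1)).add (htz _))
  have c4 : Chain m x (F :: D' :: D :: A :: zs) _ :=
    c3.cons_of_nonneg ((AffineIn.single (g := D) (by simp) (1 / 2)).add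
      (AffineIn.single (g := D') (by simp) (1 / 2))) fun y => (hF1 y).1
  obtain ⟨z5, c5, l5, s5, m5⟩ := c4.exists_tooth (g := A) (by simp) hA1 K
  obtain ⟨z6, c6, l6, s6, m6⟩ := c5.exists_tooth (g := F) (s5 (by simp)) hF1 K
  -- Both approximate squares err upwards by at most `4^(-(K+1))`. Subtracting this amount keeps the
  -- affine expression below `p t ≤ 1`, so after rectification the result stays in `[0,1]` and can
  -- be multiplied again.
  have c7 := c6.cons (((AffineIn.approxSq fun i hi => s6 (m5 i hi)).add
    ((AffineIn.approxSq m6).smul (-1))).const (-(1 / 4 : ℝ) ^ (K + 1)))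
  rw [show c + (1 + 2) + (1 + 2) + (1 + 2) + (1 + 1) + 4 * K + 4 * K + (1 + K + (1 + K) + 1) =
    c + (10 * K + 14) by ring] at c7
  refine ⟨_, c7, ?_, _, List.mem_cons_self, fun y => ?_⟩
  · simp only [List.length_cons, l6, l5]
    ring
  · have e1 := approxSq_mem K (hA1 y)
    have e2 := approxSq_mem K (hF1 y)
    have e3 : A y ^ 2 - F y ^ 2 = p y * t y := by
      rw [hF', div_pow, sq_abs, hA]
      ring
    obtain ⟨h1, h2⟩ := hp1 y
    obtain ⟨h3, h4⟩ := ht1 y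
    have hpt : 0 ≤ p y * t y := mul_nonneg h1 h3
    have hpt1 : p y * t y ≤ 1 := mul_le_one₀ h2 h3 h4
    obtain ⟨a1, a2⟩ := e1
    obtain ⟨b1, b2⟩ := e2
    have hK : (1 / 4 : ℝ) ^ (K + 1) = (1 / 4 : ℝ) ^ K / 4 := by rw [pow_succ]; ring
    have hK0 : 0 < (1 / 4 : ℝ) ^ K := by positivity
    rw [hK] at a2 b2 ⊢
    refine ⟨⟨le_max_right _ _, max_le (by linarith) zero_le_one⟩, abs_le.mpr ⟨?_, ?_⟩⟩
    · have := le_max_left (approxSq K (A y) + -1 * approxSq K (F y) + -((1 / 4 : ℝ) ^ K / 4)) 0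
      linarith
    · have := max_le (show approxSq K (A y) + -1 * approxSq K (F y) + -((1 / 4 : ℝ) ^ K / 4) ≤
        p y * t y by linarith) hpt
      linarith

/-- A chain which approximates a product of factors with values in `[0,1]`. -/
lemma exists_chain_prod (ts : List (E → ℝ)) (ht : ∀ t ∈ ts, AffineIn m x [] 2 t)
    (ht1 : ∀ t ∈ ts, ∀ y, t y ∈ Set.Icc (0 : ℝ) 1) (K : ℕ) :
    ∃ zs, Chain m x zs (1 + ts.length * (10 * K + 14)) ∧
      zs.length = 1 + ts.length * (4 * K + 5) ∧
      ∃ p ∈ zs, ∀ y, p y ∈ Set.Icc (0 : ℝ) 1 ∧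
        |p y - (ts.map fun t => t y).prod| ≤ ts.length * (1 / 4 : ℝ) ^ K := by
  induction ts with
  | nil =>
    refine ⟨[fun _ => 1], ?_, by simp, _, List.mem_cons_self, fun y => by simp⟩
    have h1 : AffineIn m x [] 1 fun _ => (1 : ℝ) :=
      ((AffineIn.zero (m := m) (x := x) (zs := [])).const 1).congr fun y => by simp
    have := (Chain.nil (m := m) (x := x)).cons_of_nonneg h1 fun y => zero_le_one
    simpa using this
  | cons t ts ih =>
    obtain ⟨zs, hc, hl, p, hp, hpy⟩ := ih (fun s hs => ht s (List.mem_cons_of_mem _ hs))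
      (fun s hs => ht1 s (List.mem_cons_of_mem _ hs))
    obtain ⟨zs', hc', hl', p', hp', hpy'⟩ := hc.exists_mul hp (fun y => (hpy y).1)
      (ht t List.mem_cons_self) (ht1 t List.mem_cons_self) K
    refine ⟨zs', ?_, ?_, p', hp', fun y => ⟨(hpy' y).1, ?_⟩⟩
    · convert hc' using 1
      simp only [List.length_cons]
      ring
    · rw [hl', hl]
      simp only [List.length_cons]
      ring
    · obtain ⟨h3, h4⟩ := ht1 t List.mem_cons_self y
      have h5 := (hpy y).2
      have h6 := (hpy' y).2
      rw [List.map_cons, List.prod_cons]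
      set P := (ts.map fun t => t y).prod
      -- As `0 ≤ t ≤ 1`, the inherited error is not amplified and the errors just add up.
      calc |p' y - t y * P| = |(p' y - p y * t y) + t y * (p y - P)| := by congr 1; ring
        _ ≤ |p' y - p y * t y| + |t y * (p y - P)| := abs_add_le _ _
        _ = |p' y - p y * t y| + t y * |p y - P| := by rw [abs_mul, abs_of_nonneg h3]
        _ ≤ (1 / 4 : ℝ) ^ K + 1 * (ts.length * (1 / 4 : ℝ) ^ K) :=
            add_le_add h6 (mul_le_mul h4 h5 (abs_nonneg _) zero_le_one)
        _ = _ := by push_cast [List.length_cons]; ring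

/-! ### From chains to weights -/

/-- `1` for nonzero numbers, `0` for zero. -/
def nz (r : ℝ) : ℕ := if r = 0 then 0 else 1

@[simp] lemma nz_zero : nz 0 = 0 := if_pos rfl

lemma nz_le_one (r : ℝ) : nz r ≤ 1 := by unfold nz; split_ifs <;> simp

lemma nz_add_le (r s : ℝ) : nz (r + s) ≤ nz r + 1 := (nz_le_one _).trans (by omega)

lemma sum_nz_add_single_le (n : ℕ) (u : ℕ → ℝ) (k : ℕ) (r : ℝ) :
    ∑ i ∈ Finset.range n, nz ((u + Pi.single k r : ℕ → ℝ) i) ≤ ∑ i ∈ Finset.range n, nz (u i) + 1 := by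
  have h : ∀ i ∈ Finset.range n, nz ((u + Pi.single k r : ℕ → ℝ) i) ≤ nz (u i) + if i = k then 1 else 0 := by
    intro i _
    rw [Pi.add_apply]
    split_ifs with h
    · exact nz_add_le _ _
    · rw [Pi.single_eq_of_ne h, add_zero, add_zero]
  refine (Finset.sum_le_sum h).trans ?_
  rw [Finset.sum_add_distrib, Finset.sum_ite_eq']
  split_ifs <;> simp

lemma sum_add_single_mul (n : ℕ) (u : ℕ → ℝ) {k : ℕ} (hk : k < n) (r : ℝ) (z : ℕ → ℝ) :
    ∑ i ∈ Finset.range n, (u + Pi.single k r : ℕ → ℝ) i * z i =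
      ∑ i ∈ Finset.range n, u i * z i + r * z k := by
  simp only [Pi.add_apply, add_mul, Finset.sum_add_distrib]
  congr 1
  rw [Finset.sum_eq_single k]
  · simp
  · intro i _ hi
    simp [hi]
  · intro h
    exact absurd (Finset.mem_range.mpr hk) h

/-- Repeated use of the same input or neuron merges into one coefficient, possibly zero; hence the
count is an inequality. -/
lemma AffineIn.exists_weights (h : AffineIn m x zs c f) (n : ℕ) (z : ℕ → E → ℝ)
    (hz : ∀ g ∈ zs, ∃ i < n, z i = g) :
    ∃ (u w : ℕ → ℝ) (b : ℝ),
      (∀ y, f y = ∑ k ∈ Finset.range m, u k * x k y + ∑ i ∈ Finset.range n, w i * z i y + b) ∧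
      ∑ k ∈ Finset.range m, nz (u k) + ∑ i ∈ Finset.range n, nz (w i) + nz b ≤ c := by
  induction h with
  | zero => exact ⟨0, 0, 0, by simp, by simp⟩
  | input r k hk _ ih =>
    obtain ⟨u, w, b, h1, h2⟩ := ih
    refine ⟨u + Pi.single k r, w, b, fun y => ?_, ?_⟩
    · beta_reduce
      rw [h1, sum_add_single_mul m u hk r fun k => x k y]
      ring
    · have := sum_nz_add_single_le m u k r
      omega
  | neuron r g hg _ ih =>
    obtain ⟨u, w, b, h1, h2⟩ := ih
    obtain ⟨i, hi, rfl⟩ := hz g hg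
    refine ⟨u, w + Pi.single i r, b, fun y => ?_, ?_⟩
    · beta_reduce
      rw [h1, sum_add_single_mul n w hi r fun i => z i y]
      ring
    · have := sum_nz_add_single_le n w i r
      omega
  | const r _ ih =>
    obtain ⟨u, w, b, h1, h2⟩ := ih
    refine ⟨u, w, b + r, fun y => ?_, ?_⟩
    · beta_reduce
      rw [h1]
      ring
    · have := nz_add_le b r
      omega

/-- The list has its newest neuron at the head, whereas `z` is indexed by time; the new neuron
receives the index `zs.length`. -/
lemma Chain.exists_weights (h : Chain m x zs c) :
    ∃ (z : ℕ → E → ℝ) (u w : ℕ → ℕ → ℝ) (b : ℕ → ℝ),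
      (∀ g ∈ zs, ∃ i < zs.length, z i = g) ∧
      (∀ t < zs.length, ∀ y, z t y = max (∑ k ∈ Finset.range m, u t k * x k y +
        ∑ i ∈ Finset.range t, w t i * z i y + b t) 0) ∧
      ∑ t ∈ Finset.range zs.length, (∑ k ∈ Finset.range m, nz (u t k) +
        ∑ i ∈ Finset.range t, nz (w t i) + nz (b t)) ≤ c := by
  induction h with
  | nil => exact ⟨0, 0, 0, 0, by simp, by simp, by simp⟩
  | @cons zs c d f _ hf ih =>
    obtain ⟨z, u, w, b, h1, h2, h3⟩ := ih
    obtain ⟨u', w', b', e1, e2⟩ := hf.exists_weights zs.length z h1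
    set n := zs.length with hn
    refine ⟨Function.update z n (fun y => max (f y) 0), Function.update u n u',
      Function.update w n w', Function.update b n b', ?_, ?_, ?_⟩
    · intro g hg
      rw [List.length_cons, ← hn]
      rcases List.mem_cons.mp hg with rfl | hg
      · exact ⟨n, by omega, by simp⟩
      · obtain ⟨i, hi, rfl⟩ := h1 g hg
        exact ⟨i, by omega, by rw [Function.update_of_ne hi.ne]⟩
    · intro t ht y
      rw [List.length_cons, ← hn] at ht
      have hsum : ∀ t ≤ n, ∀ v : ℕ → ℝ, ∑ i ∈ Finset.range t,
          v i * Function.update z n (fun y => max (f y) 0) i y =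
          ∑ i ∈ Finset.range t, v i * z i y := by
        intro t ht v
        refine Finset.sum_congr rfl fun i hi => ?_
        rw [Function.update_of_ne ((Finset.mem_range.mp hi).trans_le ht).ne]
      rw [hsum t (by omega)]
      rcases (Nat.lt_succ_iff.mp ht).eq_or_lt with rfl | ht
      · simp only [Function.update_self, e1]
      · simp only [Function.update_of_ne ht.ne]
        exact h2 t ht y
    · rw [List.length_cons, ← hn, Finset.sum_range_succ]
      simp only [Function.update_self]
      refine add_le_add (le_trans (le_of_eq ?_) h3) e2
      refine Finset.sum_congr rfl fun t ht => ?_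
      simp only [Function.update_of_ne (Finset.mem_range.mp ht).ne]

/-- Parallel chains must have equal length. Padding neurons have no nonzero coefficient and are
free, and the output layer can still read the earlier ones. -/
lemma Chain.exists_length_eq (h : Chain m x zs c) (T : ℕ) (hT : zs.length ≤ T) :
    ∃ zs', Chain m x zs' c ∧ zs'.length = T ∧ zs ⊆ zs' := by
  induction T, hT using Nat.le_induction with
  | base => exact ⟨zs, h, rfl, fun _ => id⟩
  | succ T _ ih =>
    obtain ⟨zs', h1, h2, h3⟩ := ih
    exact ⟨_, h1.cons .zero, by simp [h2], fun z hz => List.mem_cons_of_mem _ (h3 hz)⟩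

end Chains

/-! ### Parallel chains as one network -/

section Assembly

variable {E : Type*}

/-- The widths of a network consisting of `W` parallel chains of length `T`. -/
def parallelWidth (m W N T ℓ : ℕ) : ℕ := if ℓ = 0 then m else if ℓ ≤ T then W else N

/-- The weights of a network consisting of `W` parallel chains of length `T`; the neuron `τ k` of
the chain `k` enters the output `j` with the coefficient `α j k`. -/
def parallelWeight (T : ℕ) (u w : ℕ → ℕ → ℕ → ℝ) (τ : ℕ → ℕ) (α : ℕ → ℕ → ℝ)
    (ℓ j i k : ℕ) : ℝ :=
  -- Layer `0` holds the inputs and layer `ℓ ≥ 1` the neurons with time index `ℓ - 1`, which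
  -- explains the shifts by one.
  if ℓ ≤ T then (if i = 0 then u j (ℓ - 1) k else if k = j then w j (ℓ - 1) (i - 1) else 0)
  else if i = 0 then 0 else if i - 1 = τ k then α j k else 0

/-- A network consisting of `W` parallel chains of length `T`. -/
def parallelNetwork (m W N T : ℕ) (hm : 0 < m) (hW : 0 < W) (hN : 0 < N) (hT : 1 ≤ T)
    (u w : ℕ → ℕ → ℕ → ℝ) (b : ℕ → ℕ → ℝ) (τ : ℕ → ℕ) (α : ℕ → ℕ → ℝ) : ReLUNetwork where
  depth := T + 1
  two_le_depth := by omega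
  width := parallelWidth m W N T
  width_pos := fun ℓ _ => by unfold parallelWidth; split_ifs <;> assumption
  weight := fun ℓ j i k => parallelWeight T u w τ α ℓ j i k
  bias := fun ℓ j => if ℓ ≤ T then b j (ℓ - 1) else 0

section

variable (m W N T : ℕ) (u w : ℕ → ℕ → ℕ → ℝ) (b : ℕ → ℕ → ℝ) (τ : ℕ → ℕ) (α : ℕ → ℕ → ℝ)

/-- A general `F` that vanishes on zero weights covers two uses: the product gives the value of a
layer, and `nz` of the first argument counts nonzero weights. -/
lemma sum_parallelWeight_hidden (z : ℕ → ℕ → ℝ) {t j : ℕ} (ht : t < T) (hj : j < W)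
    (F : ℝ → ℝ → ℝ) (hF : ∀ r, F 0 r = 0) :
    ∑ i ∈ Finset.range (t + 1), ∑ k ∈ Finset.range (parallelWidth m W N T i),
      F (parallelWeight T u w τ α (t + 1) j i k) (z i k) =
    ∑ k ∈ Finset.range m, F (u j t k) (z 0 k) +
      ∑ i ∈ Finset.range t, F (w j t i) (z (i + 1) j) := by
  rw [Finset.sum_range_succ', add_comm]
  congr 1
  · simp [parallelWidth, parallelWeight, Nat.succ_le_of_lt ht]
  · refine Finset.sum_congr rfl fun i hi => ?_
    have hi' : i + 1 ≤ T := by have := Finset.mem_range.mp hi; omega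
    rw [parallelWidth, if_neg (by omega), if_pos hi', Finset.sum_eq_single j]
    · simp [parallelWeight, Nat.succ_le_of_lt ht]
    · intro k _ hk
      simp [parallelWeight, Nat.succ_le_of_lt ht, hk, hF]
    · intro h
      exact absurd (Finset.mem_range.mpr hj) h

lemma sum_parallelWeight_output (z : ℕ → ℕ → ℝ) (j : ℕ) (hτ : ∀ k, τ k < T)
    (F : ℝ → ℝ → ℝ) (hF : ∀ r, F 0 r = 0) :
    ∑ i ∈ Finset.range (T + 1), ∑ k ∈ Finset.range (parallelWidth m W N T i),
      F (parallelWeight T u w τ α (T + 1) j i k) (z i k) =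
    ∑ k ∈ Finset.range W, F (α j k) (z (τ k + 1) k) := by
  rw [Finset.sum_range_succ', Finset.sum_eq_zero (s := Finset.range (parallelWidth m W N T 0)),
    add_zero]
  swap
  · intro k _
    simp [parallelWeight, hF]
  have h : ∀ i ∈ Finset.range T, ∑ k ∈ Finset.range (parallelWidth m W N T (i + 1)),
      F (parallelWeight T u w τ α (T + 1) j (i + 1) k) (z (i + 1) k) =
      ∑ k ∈ Finset.range W, if i = τ k then F (α j k) (z (τ k + 1) k) else 0 := by
    intro i hi
    have hi' : i + 1 ≤ T := Finset.mem_range.mp hi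
    rw [parallelWidth, if_neg (by omega), if_pos hi']
    refine Finset.sum_congr rfl fun k _ => ?_
    by_cases hik : i = τ k
    · simp [parallelWeight, hik]
    · simp [parallelWeight, hik, hF]
  rw [Finset.sum_congr rfl h, Finset.sum_comm]
  refine Finset.sum_congr rfl fun k _ => ?_
  rw [Finset.sum_ite_eq', if_pos (Finset.mem_range.mpr (hτ k))]

variable (hm : 0 < m) (hW : 0 < W) (hN : 0 < N) (hT : 1 ≤ T)

lemma parallelNetwork_layer (z : ℕ → ℕ → ℝ)
    (hz : ∀ j < W, ∀ t < T, z (t + 1) j = max (∑ k ∈ Finset.range m, u j t k * z 0 k +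
      ∑ i ∈ Finset.range t, w j t i * z (i + 1) j + b j t) 0)
    (x : Fin (parallelNetwork m W N T hm hW hN hT u w b τ α).inputDim → ℝ)
    (hx : ∀ k, x k = z 0 k) (ℓ : ℕ) (hℓ : ℓ ≤ T)
    (j : Fin ((parallelNetwork m W N T hm hW hN hT u w b τ α).width ℓ)) :
    (parallelNetwork m W N T hm hW hN hT u w b τ α).layer x ℓ j = z ℓ j := by
  induction ℓ using Nat.strong_induction_on with
  | _ ℓ ih =>
    cases ℓ with
    | zero => rw [ReLUNetwork.layer]; exact hx j
    | succ t =>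
      have hj : (j : ℕ) < W := by
        have := j.2
        change (j : ℕ) < parallelWidth m W N T (t + 1) at this
        rwa [parallelWidth, if_neg (by omega), if_pos hℓ] at this
      rw [ReLUNetwork.layer, hz j hj t hℓ,
        ← sum_parallelWeight_hidden m W N T u w τ α z hℓ hj (fun r s => r * s) (by simp),
        ← Fin.sum_univ_eq_sum_range (fun i => ∑ k ∈ Finset.range (parallelWidth m W N T i),
          parallelWeight T u w τ α (t + 1) j i k * z i k)]
      have hb : (parallelNetwork m W N T hm hW hN hT u w b τ α).bias (t + 1) j = b j t := by
        simp [parallelNetwork, Nat.succ_le_of_lt hℓ]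
      beta_reduce
      rw [hb]
      refine congrArg (fun r => max (r + b j t) 0) (Finset.sum_congr rfl fun i _ => ?_)
      rw [← Fin.sum_univ_eq_sum_range]
      refine Finset.sum_congr rfl fun k _ => ?_
      rw [ih i i.2 (by have := i.2; omega)]
      rfl

lemma parallelNetwork_eval (z : ℕ → ℕ → ℝ) (hτ : ∀ k, τ k < T)
    (hz : ∀ j < W, ∀ t < T, z (t + 1) j = max (∑ k ∈ Finset.range m, u j t k * z 0 k +
      ∑ i ∈ Finset.range t, w j t i * z (i + 1) j + b j t) 0)
    (x : Fin (parallelNetwork m W N T hm hW hN hT u w b τ α).inputDim → ℝ)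
    (hx : ∀ k, x k = z 0 k)
    (j : Fin (parallelNetwork m W N T hm hW hN hT u w b τ α).outputDim) :
    (parallelNetwork m W N T hm hW hN hT u w b τ α).eval x j =
      ∑ k ∈ Finset.range W, α j k * z (τ k + 1) k := by
  rw [ReLUNetwork.eval, ← sum_parallelWeight_output m W N T u w τ α z j hτ (fun r s => r * s)
    (by simp), ← Fin.sum_univ_eq_sum_range (fun i =>
      ∑ k ∈ Finset.range (parallelWidth m W N T i), parallelWeight T u w τ α (T + 1) j i k * z i k)]
  have hb : (parallelNetwork m W N T hm hW hN hT u w b τ α).bias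
      (parallelNetwork m W N T hm hW hN hT u w b τ α).depth j = 0 := by
    simp [parallelNetwork]
  rw [hb, add_zero]
  refine Finset.sum_congr rfl fun i _ => ?_
  rw [← Fin.sum_univ_eq_sum_range]
  refine Finset.sum_congr rfl fun k _ => ?_
  rw [parallelNetwork_layer m W N T u w b τ α hm hW hN hT z hz x hx i (Nat.lt_succ_iff.mp i.2)]
  rfl

lemma parallelNetwork_size (hτ : ∀ k, τ k < T) :
    (parallelNetwork m W N T hm hW hN hT u w b τ α).size =
      ∑ j ∈ Finset.range W, ∑ t ∈ Finset.range T, (∑ k ∈ Finset.range m, nz (u j t k) +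
        ∑ i ∈ Finset.range t, nz (w j t i) + nz (b j t)) +
      ∑ j ∈ Finset.range N, ∑ k ∈ Finset.range W, nz (α j k) := by
  have h0 : (parallelNetwork m W N T hm hW hN hT u w b τ α).size =
      ∑ ℓ ∈ Finset.Icc 1 (T + 1), ∑ j ∈ Finset.range (parallelWidth m W N T ℓ),
        (∑ i ∈ Finset.range ℓ, ∑ k ∈ Finset.range (parallelWidth m W N T i),
          nz (parallelWeight T u w τ α ℓ j i k) + nz (if ℓ ≤ T then b j (ℓ - 1) else 0)) := by
    rw [ReLUNetwork.size]
    refine Finset.sum_congr rfl fun ℓ _ => ?_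
    rw [← Fin.sum_univ_eq_sum_range]
    refine Finset.sum_congr rfl fun j _ => ?_
    rw [← Fin.sum_univ_eq_sum_range (fun i => ∑ k ∈ Finset.range (parallelWidth m W N T i),
          nz (parallelWeight T u w τ α ℓ j i k))]
    congr 1
    refine Finset.sum_congr rfl fun i _ => ?_
    rw [← Fin.sum_univ_eq_sum_range]
    rfl
  rw [h0, ← Finset.Ico_succ_right_eq_Icc, Finset.sum_Ico_eq_sum_range]
  simp only [Order.succ_eq_add_one, Nat.add_sub_cancel]
  rw [Finset.sum_range_succ, Finset.sum_comm (s := Finset.range W) (t := Finset.range T)]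
  congr 1
  · refine Finset.sum_congr rfl fun t ht => ?_
    have ht' : t < T := Finset.mem_range.mp ht
    rw [add_comm 1 t]
    refine Finset.sum_congr ?_ fun j hj => ?_
    · rw [parallelWidth, if_neg (by omega), if_pos (by omega)]
    · have := sum_parallelWeight_hidden m W N T u w τ α 0 ht' (Finset.mem_range.mp hj)
        (fun r _ => (nz r : ℝ)) (by simp)
      rw [if_pos (by omega), Nat.add_sub_cancel]
      congr 1
      exact_mod_cast this
  · rw [add_comm 1 T]
    refine Finset.sum_congr ?_ fun j hj => ?_
    · rw [parallelWidth, if_neg (by omega), if_neg (by omega)]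
    · have := sum_parallelWeight_output m W N T u w τ α 0 j hτ
        (fun r _ => (nz r : ℝ)) (by simp)
      rw [if_neg (by omega), nz_zero, add_zero]
      exact_mod_cast this

end

/-- Parallel chains whose neurons are combined linearly in the output layer form a network. -/
theorem exists_network_of_chains {I O : Type*} [Fintype I] [Fintype O] [Nonempty I] [Nonempty O]
    {m T : ℕ} (hm : 0 < m) (hT : 1 ≤ T) (x : ℕ → E → ℝ) (zs : I → List (E → ℝ)) (c : I → ℕ)
    (hc : ∀ i, Chain m x (zs i) (c i)) (hl : ∀ i, (zs i).length ≤ T) (p : I → E → ℝ)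
    (hp : ∀ i, p i ∈ zs i) (α : O → I → ℝ) :
    ∃ (Φ : ReLUNetwork) (e : O ≃ Fin Φ.outputDim), Φ.depth = T + 1 ∧ Φ.inputDim = m ∧
      Φ.size ≤ ∑ i, c i + ∑ o, ∑ i, nz (α o i) ∧
      ∀ (y : E) (X : Fin Φ.inputDim → ℝ), (∀ k, X k = x k y) →
        ∀ o, Φ.eval X (e o) = ∑ i, α o i * p i y := by
  have hc' : ∀ i, ∃ zs', Chain m x zs' (c i) ∧ zs'.length = T ∧ p i ∈ zs' := fun i => by
    obtain ⟨zs', h1, h2, h3⟩ := (hc i).exists_length_eq T (hl i)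
    exact ⟨zs', h1, h2, h3 (hp i)⟩
  choose zs' hz1 hz2 hz3 using hc'
  choose z u w b hw1 hw2 hw3 using fun i => (hz1 i).exists_weights
  choose τ hτ1 hτ2 using fun i => hw1 i (p i) (hz3 i)
  simp only [hz2] at hτ1 hw2 hw3
  let eI := Fintype.equivFin I
  let eO := Fintype.equivFin O
  -- The default value never enters a sum. It makes `τ ∘ dI` bounded by `T` at every index, as the
  -- network lemmas require.
  let dI : ℕ → I := fun j => if h : j < Fintype.card I then eI.symm ⟨j, h⟩ else Classical.arbitrary I
  let dO : ℕ → O := fun j => if h : j < Fintype.card O then eO.symm ⟨j, h⟩ else Classical.arbitrary O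
  have sI : ∀ {M : Type} [AddCommMonoid M] (F : I → M),
      ∑ j ∈ Finset.range (Fintype.card I), F (dI j) = ∑ i, F i := by
    intro M _ F
    rw [← Fin.sum_univ_eq_sum_range (fun j => F (dI j)), ← eI.symm.sum_comp]
    refine Finset.sum_congr rfl fun j _ => ?_
    simp [dI]
  have sO : ∀ {M : Type} [AddCommMonoid M] (F : O → M),
      ∑ j ∈ Finset.range (Fintype.card O), F (dO j) = ∑ i, F i := by
    intro M _ F
    rw [← Fin.sum_univ_eq_sum_range (fun j => F (dO j)), ← eO.symm.sum_comp]
    refine Finset.sum_congr rfl fun j _ => ?_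
    simp [dO]
  have hN : (parallelNetwork m (Fintype.card I) (Fintype.card O) T hm Fintype.card_pos
    Fintype.card_pos hT (u ∘ dI) (w ∘ dI) (b ∘ dI) (τ ∘ dI)
    (fun o i => α (dO o) (dI i))).outputDim = Fintype.card O := by
    change parallelWidth m (Fintype.card I) (Fintype.card O) T (T + 1) = _
    rw [parallelWidth, if_neg (by omega), if_neg (by omega)]
  refine ⟨parallelNetwork m (Fintype.card I) (Fintype.card O) T hm Fintype.card_pos
    Fintype.card_pos hT (u ∘ dI) (w ∘ dI) (b ∘ dI) (τ ∘ dI) (fun o i => α (dO o) (dI i)),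
    eO.trans (finCongr hN.symm), rfl, rfl, ?_, ?_⟩
  · rw [parallelNetwork_size (τ := τ ∘ dI) (hτ := fun k => hτ1 (dI k))]
    refine add_le_add ?_ (le_of_eq ?_)
    · refine (Finset.sum_le_sum fun j _ => hw3 (dI j)).trans (le_of_eq (sI c))
    · rw [sO fun o => ∑ k ∈ Finset.range (Fintype.card I), nz (α o (dI k))]
      exact Finset.sum_congr rfl fun o _ => sI fun i => nz (α o i)
  · intro y X hX o
    rw [parallelNetwork_eval m (Fintype.card I) (Fintype.card O) T (u ∘ dI) (w ∘ dI) (b ∘ dI)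
      (τ ∘ dI) (fun o i => α (dO o) (dI i)) hm Fintype.card_pos Fintype.card_pos hT
      (fun ℓ j => if ℓ = 0 then x j y else z (dI j) (ℓ - 1) y) (fun k => hτ1 (dI k)) ?_ X
      (by simpa using hX)]
    · have ho : dO (eO.trans (finCongr hN.symm) o) = o := by
        simp [dO]
      rw [ho, ← sI]
      refine Finset.sum_congr rfl fun j _ => ?_
      rw [if_neg (by omega), Nat.add_sub_cancel, Function.comp_apply, hτ2]
    · intro j _ t ht
      simpa using hw2 (dI j) t ht y

end Assembly

/-! ## Sums over finitely supported multi-indices -/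

/-- The total degree of a multi-index. -/
def totalDegree (s : ℕ →₀ ℕ) : ℕ := ∑ j ∈ s.support, s j

/-- This absorbs the degree factor of the network size into a second factor `∏ (s_j+1)`, which is
why squares are summed below. -/
lemma totalDegree_add_one_le (s : ℕ →₀ ℕ) : totalDegree s + 1 ≤ ∏ j ∈ s.support, (s j + 1) := by
  unfold totalDegree
  induction s.support using Finset.induction_on with
  | empty => simp
  | insert i S hi ih =>
    rw [Finset.sum_insert hi, Finset.prod_insert hi]
    have h1 : s i * 1 ≤ s i * ∏ j ∈ S, (s j + 1) :=
      Nat.mul_le_mul_left _ (Finset.prod_pos fun j _ => Nat.succ_pos _)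
    rw [add_mul]
    omega

lemma totalDegree_pos {s : ℕ →₀ ℕ} (hs : s ≠ 0) : 1 ≤ totalDegree s := by
  obtain ⟨j, hj⟩ := Finsupp.ne_iff.mp hs
  have hj' : j ∈ s.support := Finsupp.mem_support_iff.mpr hj
  exact (Nat.one_le_iff_ne_zero.mpr hj).trans
    (Finset.single_le_sum (f := fun j => s j) (fun _ _ => Nat.zero_le _) hj')

/-- Summability puts all but finitely many values below `1/2`; the others have a maximum. This
uniform rate makes degrees logarithmic. -/
lemma exists_uniform_bound_lt_one {r : ℕ → ℝ} (h1 : ∀ j, r j < 1) (hr : Summable r) :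
    ∃ t : ℝ, 0 < t ∧ t < 1 ∧ ∀ j, r j ≤ t := by
  obtain ⟨N, hN⟩ := Filter.eventually_atTop.mp
    (hr.tendsto_atTop_zero.eventually (gt_mem_nhds (show (0 : ℝ) < 1 / 2 by norm_num)))
  obtain ⟨i, _, hi⟩ := Finset.exists_max_image (Finset.range (N + 1)) r ⟨0, by simp⟩
  refine ⟨max (1 / 2) (r i), lt_max_of_lt_left (by norm_num), max_lt (by norm_num) (h1 i),
    fun j => ?_⟩
  rcases le_total N j with h | h
  · exact (hN j h).le.trans (le_max_left _ _)
  · exact (hi j (Finset.mem_range.mpr (by omega))).trans (le_max_right _ _)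

/-- The term `k = 0` is one and all others contain a factor `r`. The bound is linear in `r` with `B`
independent of `r`, so the product over all coordinates converges. -/
lemma exists_sum_sq_mul_pow_le {t : ℝ} (ht0 : 0 ≤ t) (ht1 : t < 1) :
    ∃ B : ℝ, 0 ≤ B ∧ ∀ r : ℝ, 0 ≤ r → r ≤ t → ∀ R : ℕ,
      ∑ k ∈ Finset.range R, ((k : ℝ) + 1) ^ 2 * r ^ k ≤ 1 + B * r := by
  have hs : Summable fun k : ℕ => ((k : ℝ) + 2) ^ 2 * t ^ k := by
    have hn : ‖t‖ < 1 := by rwa [Real.norm_of_nonneg ht0]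
    have h2 := summable_pow_mul_geometric_of_norm_lt_one 2 hn
    have h1 := (summable_pow_mul_geometric_of_norm_lt_one 1 hn).mul_left 4
    have h0 := (summable_pow_mul_geometric_of_norm_lt_one 0 hn).mul_left 4
    refine ((h2.add h1).add h0).congr fun k => ?_
    ring
  refine ⟨∑' k : ℕ, ((k : ℝ) + 2) ^ 2 * t ^ k, tsum_nonneg fun k => by positivity,
    fun r hr0 hr R => ?_⟩
  have hle : ∑ k ∈ Finset.range R, ((k : ℝ) + 2) ^ 2 * t ^ k ≤
      ∑' k : ℕ, ((k : ℝ) + 2) ^ 2 * t ^ k := hs.sum_le_tsum _ fun k _ => by positivity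
  calc ∑ k ∈ Finset.range R, ((k : ℝ) + 1) ^ 2 * r ^ k
      ≤ ∑ k ∈ Finset.range (R + 1), ((k : ℝ) + 1) ^ 2 * r ^ k :=
        Finset.sum_le_sum_of_subset_of_nonneg (Finset.range_mono (Nat.le_succ R))
          fun k _ _ => by positivity
    _ = 1 + ∑ k ∈ Finset.range R, ((k : ℝ) + 2) ^ 2 * r ^ (k + 1) := by
        rw [Finset.sum_range_succ', add_comm]
        congr 1
        · simp
        · refine Finset.sum_congr rfl fun k _ => ?_
          push_cast
          ring
    _ ≤ 1 + (∑ k ∈ Finset.range R, ((k : ℝ) + 2) ^ 2 * t ^ k) * r := by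
        rw [Finset.sum_mul]
        refine add_le_add le_rfl (Finset.sum_le_sum fun k _ => ?_)
        rw [pow_succ r k, ← mul_assoc]
        gcongr
    _ ≤ _ := by gcongr

/-- The polynomially weighted generating function of all multi-indices is finite. -/
lemma exists_sum_multiIndex_le {r : ℕ → ℝ} (h0 : ∀ j, 0 ≤ r j) (h1 : ∀ j, r j < 1)
    (hr : Summable r) :
    ∃ A : ℝ, 0 < A ∧ ∀ F : Finset (ℕ →₀ ℕ),
      ∑ s ∈ F, ∏ j ∈ s.support, (((s j : ℝ) + 1) ^ 2 * r j ^ s j) ≤ A := by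
  obtain ⟨t, ht0, ht1, ht⟩ := exists_uniform_bound_lt_one h1 hr
  obtain ⟨B, hB0, hB⟩ := exists_sum_sq_mul_pow_le ht0.le ht1
  refine ⟨Real.exp (B * ∑' j, r j), Real.exp_pos _, fun F => ?_⟩
  set S := F.biUnion Finsupp.support with hS
  set R := F.sup (fun s => s.support.sup s) + 1 with hR
  have hsub : ∀ s ∈ F, s.support ⊆ S := fun s hs => Finset.subset_biUnion_of_mem _ hs
  have hlt : ∀ s ∈ F, ∀ j, s j < R := by
    intro s hs j
    refine Nat.lt_succ_of_le ?_
    by_cases hj : j ∈ s.support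
    · exact (Finset.le_sup (f := s) hj).trans
        (Finset.le_sup (f := fun s : ℕ →₀ ℕ => s.support.sup s) hs)
    · rw [Finsupp.notMem_support_iff.mp hj]
      exact Nat.zero_le _
  set h : ℕ → ℕ → ℝ := fun j k => ((k : ℝ) + 1) ^ 2 * r j ^ k with hh
  have hh0 : ∀ j k, 0 ≤ h j k := fun j k => by have := h0 j; positivity
  have hinj : Set.InjOn (fun (s : ℕ →₀ ℕ) (x : S) => s x) F := by
    intro s hs s' hs' hss
    ext j
    by_cases hj : j ∈ S
    · exact congrFun hss ⟨j, hj⟩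
    · rw [Finsupp.notMem_support_iff.mp fun h => hj (hsub s hs h),
        Finsupp.notMem_support_iff.mp fun h => hj (hsub s' hs' h)]
  -- Restriction to `S` embeds `F` into the box of exponents below `R`. The sum over the box is a
  -- product of one-variable sums, each at most `1 + B r_j ≤ exp (B r_j)`, a bound free of `S` and
  -- `R`.
  calc ∑ s ∈ F, ∏ j ∈ s.support, h j (s j)
      = ∑ s ∈ F, ∏ x : S, h x (s x) := by
        refine Finset.sum_congr rfl fun s hs => ?_
        rw [Finset.prod_coe_sort S fun j => h j (s j)]
        refine Finset.prod_subset (hsub s hs) fun j _ hj => ?_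
        rw [Finsupp.notMem_support_iff.mp hj]
        simp [hh]
    _ = ∑ p ∈ F.image (fun (s : ℕ →₀ ℕ) (x : S) => s x), ∏ x : S, h x (p x) :=
        (Finset.sum_image (f := fun p : S → ℕ => ∏ x : S, h x (p x)) hinj).symm
    _ ≤ ∑ p ∈ Fintype.piFinset (fun _ : S => Finset.range R), ∏ x : S, h x (p x) := by
        refine Finset.sum_le_sum_of_subset_of_nonneg ?_ fun p _ _ =>
          Finset.prod_nonneg fun x _ => hh0 _ _
        intro p hp
        obtain ⟨s, hs, rfl⟩ := Finset.mem_image.mp hp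
        exact Fintype.mem_piFinset.mpr fun x => Finset.mem_range.mpr (hlt s hs x)
    _ = ∏ j ∈ S, ∑ k ∈ Finset.range R, h j k :=
        (prod_sum_eq_sum_piFinset S (fun _ => Finset.range R) h).symm
    _ ≤ ∏ j ∈ S, Real.exp (B * r j) := by
        refine Finset.prod_le_prod (fun j _ => Finset.sum_nonneg fun k _ => hh0 j k)
          fun j _ => (hB (r j) (h0 j) (ht j) R).trans ?_
        rw [add_comm]
        exact Real.add_one_le_exp _
    _ = Real.exp (B * ∑ j ∈ S, r j) := by rw [← Real.exp_sum, Finset.mul_sum]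
    _ ≤ _ := by
        have := hr.sum_le_tsum S fun j _ => h0 j
        gcongr

/-! ## The index sets -/

section Weights

variable {a b q : ℝ} {δ ρ : ℕ → ℝ} {ξ : ℝ} {s : ℕ →₀ ℕ}

lemma gpcWeight_eq_prod (a b : ℝ) (ρ : ℕ → ℝ) (s : ℕ →₀ ℕ) :
    gpcWeight a b ρ s = ∏ j ∈ s.support, ((jacobiConst a b (s j))⁻¹ * ρ j ^ s j) := by
  rw [gpcWeight, Finset.prod_mul_distrib, Finset.prod_inv_distrib]

lemma pow_le_gpcFactor (ha : -1 < a) (hb : -1 < b) (hδ : ∀ j, 1 < δ j) (hρ : ∀ j, 0 < ρ j)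
    (hρδ : ∀ k j : ℕ, 1 ≤ k → jacobiConst a b k * (ρ j ^ k)⁻¹ ≤ (δ j ^ k)⁻¹) {k : ℕ} (hk : 1 ≤ k)
    (j : ℕ) : δ j ^ k ≤ (jacobiConst a b k)⁻¹ * ρ j ^ k := by
  have hc := jacobiConst_pos a b ha hb k
  have hρk : 0 < ρ j ^ k := pow_pos (hρ j) k
  have hδk : 0 < δ j ^ k := pow_pos (one_pos.trans (hδ j)) k
  have h := inv_anti₀ (by positivity) (hρδ k j hk)
  rwa [inv_inv, mul_inv, inv_inv] at h

lemma prod_pow_le_gpcWeight (ha : -1 < a) (hb : -1 < b) (hδ : ∀ j, 1 < δ j) (hρ : ∀ j, 0 < ρ j)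
    (hρδ : ∀ k j : ℕ, 1 ≤ k → jacobiConst a b k * (ρ j ^ k)⁻¹ ≤ (δ j ^ k)⁻¹) (s : ℕ →₀ ℕ) :
    ∏ j ∈ s.support, δ j ^ s j ≤ gpcWeight a b ρ s := by
  rw [gpcWeight_eq_prod]
  refine Finset.prod_le_prod (fun j _ => (pow_pos (one_pos.trans (hδ j)) _).le) fun j hj => ?_
  exact pow_le_gpcFactor ha hb hδ hρ hρδ
    (Nat.one_le_iff_ne_zero.mpr (Finsupp.mem_support_iff.mp hj)) j

lemma one_le_gpcFactor (ha : -1 < a) (hb : -1 < b) (hδ : ∀ j, 1 < δ j) (hρ : ∀ j, 0 < ρ j)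
    (hρδ : ∀ k j : ℕ, 1 ≤ k → jacobiConst a b k * (ρ j ^ k)⁻¹ ≤ (δ j ^ k)⁻¹) {j : ℕ}
    (hj : j ∈ s.support) : 1 ≤ (jacobiConst a b (s j))⁻¹ * ρ j ^ s j :=
  (one_le_pow₀ (hδ j).le).trans (pow_le_gpcFactor ha hb hδ hρ hρδ
    (Nat.one_le_iff_ne_zero.mpr (Finsupp.mem_support_iff.mp hj)) j)

lemma one_le_gpcWeight (ha : -1 < a) (hb : -1 < b) (hδ : ∀ j, 1 < δ j) (hρ : ∀ j, 0 < ρ j)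
    (hρδ : ∀ k j : ℕ, 1 ≤ k → jacobiConst a b k * (ρ j ^ k)⁻¹ ≤ (δ j ^ k)⁻¹) (s : ℕ →₀ ℕ) :
    1 ≤ gpcWeight a b ρ s := by
  rw [gpcWeight_eq_prod, ← Finset.prod_const_one (s := s.support)]
  exact Finset.prod_le_prod (fun _ _ => zero_le_one)
    fun j hj => one_le_gpcFactor ha hb hδ hρ hρδ hj

lemma gpcFactor_le_gpcWeight (ha : -1 < a) (hb : -1 < b) (hδ : ∀ j, 1 < δ j) (hρ : ∀ j, 0 < ρ j)
    (hρδ : ∀ k j : ℕ, 1 ≤ k → jacobiConst a b k * (ρ j ^ k)⁻¹ ≤ (δ j ^ k)⁻¹) {j : ℕ}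
    (hj : j ∈ s.support) : (jacobiConst a b (s j))⁻¹ * ρ j ^ s j ≤ gpcWeight a b ρ s := by
  rw [gpcWeight_eq_prod, ← Finset.mul_prod_erase _ _ hj]
  refine le_mul_of_one_le_right (zero_le_one.trans (one_le_gpcFactor ha hb hδ hρ hρδ hj)) ?_
  rw [← Finset.prod_const_one (s := s.support.erase j)]
  exact Finset.prod_le_prod (fun _ _ => zero_le_one)
    fun i hi => one_le_gpcFactor ha hb hδ hρ hρδ (Finset.mem_of_mem_erase hi)

lemma inv_rpow_bounds (hq : 0 < q) (hδ : ∀ j, 1 < δ j) (j : ℕ) :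
    0 < (δ j)⁻¹ ^ q ∧ (δ j)⁻¹ ^ q < 1 := by
  have h0 : 0 < δ j := one_pos.trans (hδ j)
  exact ⟨by positivity, Real.rpow_lt_one (by positivity) (inv_lt_one_of_one_lt₀ (hδ j)) hq⟩

/-- From `∏ δ_j^(s_j) ≤ σ_s` and `σ_s^q ≤ ξ`. Inserting this factor `≥ 1` into a sum over `Λ(ξ)`
bounds it by `ξ` times a convergent series. -/
lemma one_le_mul_prod_of_mem_indexSet (ha : -1 < a) (hb : -1 < b) (hq : 0 < q)
    (hδ : ∀ j, 1 < δ j) (hρ : ∀ j, 0 < ρ j)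
    (hρδ : ∀ k j : ℕ, 1 ≤ k → jacobiConst a b k * (ρ j ^ k)⁻¹ ≤ (δ j ^ k)⁻¹)
    (hs : s ∈ indexSet a b q ρ ξ) : 1 ≤ ξ * ∏ j ∈ s.support, ((δ j)⁻¹ ^ q) ^ s j := by
  have hδ0 : ∀ j, 0 < δ j := fun j => one_pos.trans (hδ j)
  have hP : 0 < ∏ j ∈ s.support, δ j ^ s j := Finset.prod_pos fun j _ => pow_pos (hδ0 j) _
  have h1 : (∏ j ∈ s.support, δ j ^ s j) ^ q ≤ ξ :=
    (Real.rpow_le_rpow hP.le (prod_pow_le_gpcWeight ha hb hδ hρ hρδ s) hq.le).trans hs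
  have h2 : ∏ j ∈ s.support, ((δ j)⁻¹ ^ q) ^ s j = ((∏ j ∈ s.support, δ j ^ s j) ^ q)⁻¹ := by
    rw [← Real.inv_rpow hP.le, ← Finset.prod_inv_distrib, ← Real.finsetProd_rpow]
    · refine Finset.prod_congr rfl fun j _ => ?_
      rw [← inv_pow, ← Real.rpow_natCast, ← Real.rpow_mul (inv_pos.mpr (hδ0 j)).le, mul_comm q,
        Real.rpow_mul (inv_pos.mpr (hδ0 j)).le, Real.rpow_natCast]
    · intro j _
      have := hδ0 j
      positivity
  have hPq : 0 < (∏ j ∈ s.support, δ j ^ s j) ^ q := Real.rpow_pos_of_pos hP q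
  rw [h2, ← div_eq_mul_inv, one_le_div hPq]
  exact h1

lemma zero_mem_indexSet (hξ : 1 ≤ ξ) : (0 : ℕ →₀ ℕ) ∈ indexSet a b q ρ ξ := by
  change gpcWeight a b ρ 0 ^ q ≤ ξ
  simpa [gpcWeight] using hξ

/-- Taking logarithms bounds the total degree by `log ξ / log (1/t)`. It also forces `s = 0` as soon
as `ξ t < 1`. -/
lemma one_le_mul_pow_totalDegree (ha : -1 < a) (hb : -1 < b) (hq : 0 < q)
    (hδ : ∀ j, 1 < δ j) (hρ : ∀ j, 0 < ρ j)
    (hρδ : ∀ k j : ℕ, 1 ≤ k → jacobiConst a b k * (ρ j ^ k)⁻¹ ≤ (δ j ^ k)⁻¹)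
    {t : ℝ} (ht : ∀ j, (δ j)⁻¹ ^ q ≤ t) (hξ : 0 ≤ ξ)
    (hs : s ∈ indexSet a b q ρ ξ) : 1 ≤ ξ * t ^ totalDegree s := by
  refine (one_le_mul_prod_of_mem_indexSet ha hb hq hδ hρ hρδ hs).trans ?_
  refine mul_le_mul_of_nonneg_left ?_ hξ
  rw [totalDegree, ← Finset.prod_pow_eq_pow_sum]
  refine Finset.prod_le_prod (fun j _ => ?_) fun j _ => ?_
  · exact pow_nonneg (inv_rpow_bounds hq hδ j).1.le _
  · exact pow_le_pow_left₀ (inv_rpow_bounds hq hδ j).1.le (ht j) _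

lemma sum_prod_sq_le (ha : -1 < a) (hb : -1 < b) (hq : 0 < q)
    (hδ : ∀ j, 1 < δ j) (hρ : ∀ j, 0 < ρ j)
    (hρδ : ∀ k j : ℕ, 1 ≤ k → jacobiConst a b k * (ρ j ^ k)⁻¹ ≤ (δ j ^ k)⁻¹) {A : ℝ}
    (hA : ∀ F : Finset (ℕ →₀ ℕ),
      ∑ s ∈ F, ∏ j ∈ s.support, (((s j : ℝ) + 1) ^ 2 * ((δ j)⁻¹ ^ q) ^ s j) ≤ A)
    (hξ : 0 ≤ ξ) {F : Finset (ℕ →₀ ℕ)} (hF : (F : Set (ℕ →₀ ℕ)) ⊆ indexSet a b q ρ ξ) :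
    ∑ s ∈ F, ∏ j ∈ s.support, ((s j : ℝ) + 1) ^ 2 ≤ A * ξ := by
  refine le_trans ?_ (mul_le_mul_of_nonneg_right (hA F) hξ)
  rw [Finset.sum_mul]
  refine Finset.sum_le_sum fun s hs => ?_
  rw [Finset.prod_mul_distrib, mul_assoc]
  refine le_mul_of_one_le_right (Finset.prod_nonneg fun j _ => by positivity) ?_
  rw [mul_comm]
  exact one_le_mul_prod_of_mem_indexSet ha hb hq hδ hρ hρδ (hF hs)

lemma card_le_of_subset_indexSet (ha : -1 < a) (hb : -1 < b) (hq : 0 < q)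
    (hδ : ∀ j, 1 < δ j) (hρ : ∀ j, 0 < ρ j)
    (hρδ : ∀ k j : ℕ, 1 ≤ k → jacobiConst a b k * (ρ j ^ k)⁻¹ ≤ (δ j ^ k)⁻¹) {A : ℝ}
    (hA : ∀ F : Finset (ℕ →₀ ℕ),
      ∑ s ∈ F, ∏ j ∈ s.support, (((s j : ℝ) + 1) ^ 2 * ((δ j)⁻¹ ^ q) ^ s j) ≤ A)
    (hξ : 0 ≤ ξ) {F : Finset (ℕ →₀ ℕ)} (hF : (F : Set (ℕ →₀ ℕ)) ⊆ indexSet a b q ρ ξ) :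
    (F.card : ℝ) ≤ A * ξ := by
  refine le_trans ?_ (sum_prod_sq_le ha hb hq hδ hρ hρδ hA hξ hF)
  rw [Finset.card_eq_sum_ones, Nat.cast_sum]
  refine Finset.sum_le_sum fun s _ => ?_
  refine le_trans (le_of_eq (by simp)) (Finset.prod_le_prod (f := fun _ => (1 : ℝ))
    (s := s.support) (fun _ _ => zero_le_one) fun j _ => ?_)
  exact one_le_pow₀ (by linarith [(Nat.cast_nonneg (s j) : (0 : ℝ) ≤ s j)])

lemma finite_indexSet (ha : -1 < a) (hb : -1 < b) (hq : 0 < q)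
    (hδ : ∀ j, 1 < δ j) (hρ : ∀ j, 0 < ρ j)
    (hρδ : ∀ k j : ℕ, 1 ≤ k → jacobiConst a b k * (ρ j ^ k)⁻¹ ≤ (δ j ^ k)⁻¹) {A : ℝ}
    (hA : ∀ F : Finset (ℕ →₀ ℕ),
      ∑ s ∈ F, ∏ j ∈ s.support, (((s j : ℝ) + 1) ^ 2 * ((δ j)⁻¹ ^ q) ^ s j) ≤ A)
    (hξ : 0 ≤ ξ) : (indexSet a b q ρ ξ).Finite := by
  by_contra hinf
  obtain ⟨F, hF, hcard⟩ := Set.Infinite.exists_subset_card_eq hinf (⌊A * ξ⌋₊ + 1)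
  have h := card_le_of_subset_indexSet ha hb hq hδ hρ hρδ hA hξ hF
  rw [hcard] at h
  push_cast at h
  linarith [Nat.lt_floor_add_one (A * ξ)]

/-- The coordinates which occur in an index set can be listed; if `ρ` is non-decreasing, an initial
segment suffices. -/
lemma exists_coordinates (ha : -1 < a) (hb : -1 < b) (hq : 0 < q)
    (hδ : ∀ j, 1 < δ j) (hδq : Summable fun j => (δ j)⁻¹ ^ q) (hρ : ∀ j, 0 < ρ j)
    (hρδ : ∀ k j : ℕ, 1 ≤ k → jacobiConst a b k * (ρ j ^ k)⁻¹ ≤ (δ j ^ k)⁻¹)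
    (hξ : 0 ≤ ξ) {m : ℕ} (hm : (∑' j, (δ j)⁻¹ ^ q) * ξ < m + 1) :
    ∃ ι : Fin m ↪ ℕ, (Monotone ρ → ∀ k, ι k = k) ∧
      ∀ s ∈ indexSet a b q ρ ξ, ∀ j ∈ s.support, ∃ k, ι k = j := by
  have hδ0 : ∀ j, 0 < δ j := fun j => one_pos.trans (hδ j)
  have hcard : ∀ G : Finset ℕ, (∀ j ∈ G, 1 ≤ ξ * (δ j)⁻¹ ^ q) → G.card ≤ m := by
    intro G hG
    have h1 : (G.card : ℝ) ≤ ∑ j ∈ G, ξ * (δ j)⁻¹ ^ q := by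
      rw [Finset.card_eq_sum_ones, Nat.cast_sum]
      exact Finset.sum_le_sum fun j hj => by simpa using hG j hj
    rw [← Finset.mul_sum] at h1
    have h2 := hδq.sum_le_tsum G fun j _ => (inv_rpow_bounds hq hδ j).1.le
    have h3 : (G.card : ℝ) < m + 1 := by
      refine (h1.trans ?_).trans_lt hm
      rw [mul_comm]
      exact mul_le_mul_of_nonneg_right h2 hξ
    exact Nat.lt_succ_iff.mp (by exact_mod_cast h3)
  -- The hypothesis on `ρ` is applied at coordinate `i` with the exponent `s j`: `δ_i ≤ c⁻¹
  -- ρ_i^(s_j) ≤ c⁻¹ ρ_j^(s_j) ≤ σ_s`. For monotone `ρ`, an active `j` thus makes all of `0, …, j`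
  -- satisfy the condition counted in `hcard`, whence `j + 1 ≤ m`.
  have key : ∀ i j : ℕ, ρ i ≤ ρ j → ∀ s ∈ indexSet a b q ρ ξ, j ∈ s.support →
      1 ≤ ξ * (δ i)⁻¹ ^ q := by
    intro i j hij s hs hj
    have hk : 1 ≤ s j := Nat.one_le_iff_ne_zero.mpr (Finsupp.mem_support_iff.mp hj)
    have h1 : δ i ≤ gpcWeight a b ρ s := calc
      δ i ≤ δ i ^ s j := le_self_pow₀ (hδ i).le (by omega)
      _ ≤ (jacobiConst a b (s j))⁻¹ * ρ i ^ s j := pow_le_gpcFactor ha hb hδ hρ hρδ hk i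
      _ ≤ (jacobiConst a b (s j))⁻¹ * ρ j ^ s j := by
        have := jacobiConst_pos a b ha hb (s j)
        have := hρ i
        gcongr
      _ ≤ _ := gpcFactor_le_gpcWeight ha hb hδ hρ hρδ hj
    have h2 : δ i ^ q ≤ ξ := (Real.rpow_le_rpow (hδ0 i).le h1 hq.le).trans hs
    rw [Real.inv_rpow (hδ0 i).le, ← div_eq_mul_inv, one_le_div (Real.rpow_pos_of_pos (hδ0 i) q)]
    exact h2
  by_cases hmono : Monotone ρ
  · refine ⟨Fin.valEmbedding, fun _ k => rfl, fun s hs j hj => ?_⟩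
    have := hcard (Finset.range (j + 1)) fun i hi =>
      key i j (hmono (Nat.lt_succ_iff.mp (Finset.mem_range.mp hi))) s hs hj
    rw [Finset.card_range] at this
    exact ⟨⟨j, this⟩, rfl⟩
  · have hfin : {j | 1 ≤ ξ * (δ j)⁻¹ ^ q}.Finite := by
      by_contra hinf
      obtain ⟨F, hF, hc⟩ := Set.Infinite.exists_subset_card_eq hinf (m + 1)
      have := hcard F fun j hj => hF hj
      omega
    -- The relevant coordinates are filled up by arbitrary others to exactly `m`.
    obtain ⟨G, hG, hGc⟩ := Infinite.exists_superset_card_eq hfin.toFinset m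
      (hcard _ fun j hj => by simpa using hj)
    refine ⟨(G.orderEmbOfFin hGc).toEmbedding, fun h => absurd h hmono, fun s hs j hj => ?_⟩
    have hjG : j ∈ G := hG (by simpa using key j j le_rfl s hs hj)
    rw [← Finset.mem_coe, ← Finset.range_orderEmbOfFin G hGc] at hjG
    exact hjG

end Weights

/-! ## Networks for tensor products of Jacobi polynomials -/

/-- The coefficients of `J_k` with respect to `u^i (1-u)^(k-i)`, `u = (1+y)/2`. -/
def bernsteinCoeff (a b : ℝ) (k i : ℕ) : ℝ :=
  jacobiConst a b k * (Ring.choose (k + a) i * Ring.choose (k + b) (k - i) * (-1) ^ (k - i))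

lemma jacobi_eq_sum_bernstein (a b : ℝ) (k : ℕ) (y : ℝ) :
    jacobi a b k y = ∑ i ∈ Finset.range (k + 1),
      bernsteinCoeff a b k i * (((1 + y) / 2) ^ i * ((1 - y) / 2) ^ (k - i)) := by
  rw [jacobi, classicalJacobi_eq_eval, jacobiPoly, Polynomial.eval_finsetSum, Finset.mul_sum]
  refine Finset.sum_congr rfl fun i _ => ?_
  simp only [Polynomial.eval_mul, Polynomial.eval_C, Polynomial.eval_pow, Polynomial.eval_sub,
    Polynomial.eval_X, Polynomial.eval_one, bernsteinCoeff]
  rw [show (1 + y) / 2 - 1 = (-1) * ((1 - y) / 2) by ring, mul_pow]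
  ring

/-- The factors `(k+a-i)/(i+1)` of the generalized binomial coefficient are nonnegative because `i <
k` and `a > -1`, and increase when `a` is rounded up; an ordinary binomial coefficient remains. -/
lemma ringChoose_bounds {a : ℝ} (ha : -1 < a) (k i : ℕ) (hi : i ≤ k) :
    0 ≤ Ring.choose ((k : ℝ) + a) i ∧ Ring.choose ((k : ℝ) + a) i ≤ 2 ^ (k + ⌈a⌉₊) := by
  have h : 0 ≤ Ring.choose ((k : ℝ) + a) i ∧
      Ring.choose ((k : ℝ) + a) i ≤ Ring.choose (((k + ⌈a⌉₊ : ℕ) : ℝ)) i := by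
    induction i with
    | zero => simp
    | succ i ih =>
      obtain ⟨h1, h2⟩ := ih (by omega)
      have hik : (i : ℝ) + 1 ≤ k := by exact_mod_cast hi
      have hca : a ≤ ⌈a⌉₊ := Nat.le_ceil a
      rw [ringChoose_succ_right, ringChoose_succ_right]
      have h3 : 0 ≤ ((k : ℝ) + a - i) / (i + 1) := div_nonneg (by linarith) (by positivity)
      refine ⟨mul_nonneg h1 h3, mul_le_mul h2 ?_ h3 (h1.trans h2)⟩
      push_cast
      gcongr
  refine ⟨h.1, h.2.trans ?_⟩
  rw [Ring.choose_natCast]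
  exact_mod_cast Nat.choose_le_two_pow _ _

/-- The number of terms, both binomial coefficients and `c_k` grow at most exponentially. For `k ≥
1` constants are absorbed into the power; for `k = 0` the sum is exactly one. A pure power `D^k` is
what multiplies to `D^|s|` over the coordinates. -/
lemma exists_sum_abs_bernsteinCoeff_le {a b : ℝ} (ha : -1 < a) (hb : -1 < b) {θ : ℝ}
    (hθ : ∀ k, 1 ≤ k → jacobiConst a b k ≤ θ ^ k) :
    ∃ D : ℝ, 1 ≤ D ∧ ∀ k, ∑ i ∈ Finset.range (k + 1), |bernsteinCoeff a b k i| ≤ D ^ k := by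
  have hθ0 : 0 ≤ θ := by
    have := (jacobiConst_pos a b ha hb 1).le.trans (hθ 1 le_rfl)
    simpa using this
  set A := ⌈a⌉₊
  set B := ⌈b⌉₊
  refine ⟨max 1 θ * (8 * 2 ^ (A + B)), ?_, fun k => ?_⟩
  · have h1 : (1 : ℝ) ≤ 2 ^ (A + B) := one_le_pow₀ (by norm_num)
    have h2 : (1 : ℝ) ≤ max 1 θ := le_max_left _ _
    nlinarith
  rcases Nat.eq_zero_or_pos k with rfl | hk
  · simp [bernsteinCoeff, jacobiConst]
  have hterm : ∀ i ∈ Finset.range (k + 1), |bernsteinCoeff a b k i| ≤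
      θ ^ k * (2 ^ (k + A) * 2 ^ (k + B)) := by
    intro i hi
    have hik := Nat.lt_succ_iff.mp (Finset.mem_range.mp hi)
    obtain ⟨p1, p2⟩ := ringChoose_bounds ha k i hik
    obtain ⟨q1, q2⟩ := ringChoose_bounds hb k (k - i) (Nat.sub_le _ _)
    rw [bernsteinCoeff, abs_mul, abs_mul, abs_mul, abs_pow, abs_neg, abs_one, one_pow, mul_one,
      abs_of_pos (jacobiConst_pos a b ha hb k), abs_of_nonneg p1, abs_of_nonneg q1]
    exact mul_le_mul (hθ k hk) (mul_le_mul p2 q2 q1 (by positivity)) (mul_nonneg p1 q1)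
      (by positivity)
  refine (Finset.sum_le_card_nsmul _ _ _ hterm).trans ?_
  rw [Finset.card_range, nsmul_eq_mul]
  have h1 : ((k + 1 : ℕ) : ℝ) ≤ 2 ^ k := by exact_mod_cast Nat.lt_two_pow_self
  have h2 : θ ^ k ≤ max 1 θ ^ k := pow_le_pow_left₀ hθ0 (le_max_right _ _) k
  have h3 : (2 : ℝ) ^ (A + B) ≤ (2 ^ (A + B)) ^ k :=
    le_self_pow₀ (one_le_pow₀ (by norm_num)) (by omega)
  calc ((k + 1 : ℕ) : ℝ) * (θ ^ k * (2 ^ (k + A) * 2 ^ (k + B)))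
      = ((k + 1 : ℕ) : ℝ) * θ ^ k * ((2 ^ k * 2 ^ k) * 2 ^ (A + B)) := by ring
    _ ≤ 2 ^ k * max 1 θ ^ k * ((2 ^ k * 2 ^ k) * (2 ^ (A + B)) ^ k) := by gcongr
    _ = _ := by
      rw [mul_pow, mul_pow, show (8 : ℝ) = 2 * 2 * 2 by norm_num, mul_pow, mul_pow]
      ring

/-- The index set of the terms in the expansion of `J_s`. -/
abbrev TermIndex (s : ℕ →₀ ℕ) : Type :=
  {p : s.support → ℕ // p ∈ Fintype.piFinset fun x : s.support => Finset.range (s x + 1)}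

/-- The factors of a term in the expansion of `J_s`. -/
def termFactors (s : ℕ →₀ ℕ) (p : s.support → ℕ) : List ((ℕ → II) → ℝ) :=
  (Finset.univ : Finset s.support).toList.flatMap fun x =>
    List.replicate (p x) (fun y => (1 + (y x : ℝ)) / 2) ++
      List.replicate (s x - p x) (fun y => (1 - (y x : ℝ)) / 2)

/-- The coefficient of a term in the expansion of `J_s`. -/
def termCoeff (a b : ℝ) (s : ℕ →₀ ℕ) (p : s.support → ℕ) : ℝ :=
  ∏ x : s.support, bernsteinCoeff a b (s x) (p x)

lemma card_termIndex (s : ℕ →₀ ℕ) :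
    Fintype.card (TermIndex s) = ∏ j ∈ s.support, (s j + 1) := by
  rw [Fintype.card_coe, Fintype.card_piFinset]
  simp only [Finset.card_range]
  exact Finset.prod_coe_sort s.support fun j => s j + 1

lemma length_termFactors (s : ℕ →₀ ℕ) (p : TermIndex s) :
    (termFactors s p.1).length = totalDegree s := by
  rw [termFactors, List.length_flatMap, totalDegree, ← Finset.sum_coe_sort, Finset.sum_map_toList]
  refine Finset.sum_congr rfl fun x _ => ?_
  have := Finset.mem_range.mp (Fintype.mem_piFinset.mp p.2 x)
  simp
  omega

lemma prod_termFactors (s : ℕ →₀ ℕ) (p : s.support → ℕ) (y : ℕ → II) :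
    ((termFactors s p).map fun t => t y).prod =
      ∏ x : s.support, (((1 + (y x : ℝ)) / 2) ^ p x * ((1 - (y x : ℝ)) / 2) ^ (s x - p x)) := by
  rw [termFactors, List.map_flatMap, List.flatMap_def, List.prod_flatten, List.map_map,
    Finset.prod_map_toList]
  refine Finset.prod_congr rfl fun x _ => ?_
  simp

/-- In Bernstein rather than monomial form every factor `(1 ± y_j)/2` lies in `[0,1]`, as the
product chains require. -/
lemma jacobiTensor_eq_sum_terms (a b : ℝ) (s : ℕ →₀ ℕ) (y : ℕ → II) :
    jacobiTensor a b s y = ∑ p : TermIndex s,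
      termCoeff a b s p.1 * ((termFactors s p.1).map fun t => t y).prod := by
  rw [Finset.sum_coe_sort (Fintype.piFinset fun x : s.support => Finset.range (s x + 1))
    fun p => termCoeff a b s p * ((termFactors s p).map fun t => t y).prod, jacobiTensor]
  simp_rw [jacobi_eq_sum_bernstein]
  rw [prod_sum_eq_sum_piFinset s.support (fun j => Finset.range (s j + 1)) fun j i =>
    bernsteinCoeff a b (s j) i * (((1 + (y j : ℝ)) / 2) ^ i * ((1 - (y j : ℝ)) / 2) ^ (s j - i))]
  refine Finset.sum_congr rfl fun p _ => ?_
  rw [prod_termFactors, Finset.prod_mul_distrib, termCoeff]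

lemma sum_abs_termCoeff_le {a b D : ℝ}
    (hD : ∀ k, ∑ i ∈ Finset.range (k + 1), |bernsteinCoeff a b k i| ≤ D ^ k) (s : ℕ →₀ ℕ) :
    ∑ p : TermIndex s, |termCoeff a b s p.1| ≤ D ^ totalDegree s := by
  rw [Finset.sum_coe_sort (Fintype.piFinset fun x : s.support => Finset.range (s x + 1))
    fun p => |termCoeff a b s p|]
  simp_rw [termCoeff, Finset.abs_prod]
  rw [← prod_sum_eq_sum_piFinset s.support (fun j => Finset.range (s j + 1)) fun j i =>
    |bernsteinCoeff a b (s j) i|, totalDegree, ← Finset.prod_pow_eq_pow_sum]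
  exact Finset.prod_le_prod (fun j _ => Finset.sum_nonneg fun i _ => abs_nonneg _)
    fun j _ => hD (s j)

/-- The inputs of the network as functions on the cube. -/
def networkInput {m : ℕ} (ι : Fin m ↪ ℕ) (k : ℕ) (y : ℕ → II) : ℝ :=
  if h : k < m then y (ι ⟨k, h⟩) else 0

lemma termFactors_affine {m : ℕ} (ι : Fin m ↪ ℕ) {s : ℕ →₀ ℕ}
    (hs : ∀ j ∈ s.support, ∃ k, ι k = j) (p : s.support → ℕ) :
    ∀ t ∈ termFactors s p, AffineIn m (networkInput ι) [] 2 t ∧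
      ∀ y, t y ∈ Set.Icc (0 : ℝ) 1 := by
  intro t ht
  obtain ⟨x, _, hx⟩ := List.mem_flatMap.mp ht
  obtain ⟨k, hk⟩ := hs x x.2
  have hin : ∀ r : ℝ, AffineIn m (networkInput ι) [] 2 fun y => 1 / 2 + r * (y x : ℝ) := fun r =>
    ((AffineIn.zero.const (1 / 2)).input r k k.2).congr fun y => by
      simp [networkInput, hk]
  have hb : ∀ y : ℕ → II, -1 ≤ (y x : ℝ) ∧ (y x : ℝ) ≤ 1 := fun y => (y x).2
  rcases List.mem_append.mp hx with h | h
  · rw [List.eq_of_mem_replicate h]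
    refine ⟨(hin (1 / 2)).congr fun y => by ring, fun y => ?_⟩
    have := hb y
    constructor <;> linarith
  · rw [List.eq_of_mem_replicate h]
    refine ⟨(hin (-1 / 2)).congr fun y => by ring, fun y => ?_⟩
    have := hb y
    constructor <;> linarith

/-- Simultaneous approximation of finitely many tensor product Jacobi polynomials. -/
theorem exists_network_jacobiTensor {a b D : ℝ}
    (hD : ∀ k, ∑ i ∈ Finset.range (k + 1), |bernsteinCoeff a b k i| ≤ D ^ k)
    {m : ℕ} (hm : 0 < m) (ι : Fin m ↪ ℕ) (Λ : Finset (ℕ →₀ ℕ)) (hΛ : Λ.Nonempty)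
    (hι : ∀ s ∈ Λ, ∀ j ∈ s.support, ∃ k, ι k = j) (K R : ℕ) (hR : ∀ s ∈ Λ, totalDegree s ≤ R) :
    ∃ (Φ : ReLUNetwork) (e : Λ ≃ Fin Φ.outputDim) (h : Φ.inputDim = m),
      Φ.depth = R * (4 * K + 5) + 3 ∧
      Φ.size ≤ ∑ s ∈ Λ, (∏ j ∈ s.support, (s j + 1)) * (totalDegree s * (10 * K + 14) + 2) ∧
      ∀ (y : ℕ → II) (s : Λ),
        |Φ.eval (fun k => (y (ι (finCongr h k)) : ℝ)) (e s) - jacobiTensor a b s y| ≤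
          D ^ totalDegree s.1 * (totalDegree s.1 * (1 / 4 : ℝ) ^ K) := by
  classical
  have hch : ∀ i : Σ s : Λ, TermIndex s.1, ∃ zs,
      Chain m (networkInput ι) zs (1 + totalDegree i.1.1 * (10 * K + 14)) ∧
      zs.length = 1 + totalDegree i.1.1 * (4 * K + 5) ∧ ∃ p ∈ zs, ∀ y,
        |p y - ((termFactors i.1.1 i.2.1).map fun t => t y).prod| ≤
          totalDegree i.1.1 * (1 / 4 : ℝ) ^ K := by
    rintro ⟨s, p⟩
    have ht := termFactors_affine ι (hι s s.2) p.1
    obtain ⟨zs, h1, h2, q, hq, h3⟩ := exists_chain_prod (termFactors s.1 p.1)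
      (fun t h => (ht t h).1) (fun t h => (ht t h).2) K
    rw [length_termFactors] at h1 h2 h3
    exact ⟨zs, h1, h2, q, hq, fun y => (h3 y).2⟩
  choose zs hc hl p hp hpy using hch
  have : Nonempty Λ := hΛ.to_subtype
  have : ∀ s : Λ, Nonempty (TermIndex s.1) := fun s => Fintype.card_pos_iff.mp (by
    rw [card_termIndex]
    exact Finset.prod_pos fun j _ => Nat.succ_pos _)
  have : Nonempty (Σ s : Λ, TermIndex s.1) :=
    ⟨⟨Classical.arbitrary Λ, Classical.arbitrary _⟩⟩
  -- Chains have length at most `1 + R (4K+5)`; one extra layer gives depth at least three even for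
  -- `R = 0`. Each chain enters only its own output, hence at most one output weight per chain.
  obtain ⟨Φ, e, hd, hin, hsz, hev⟩ := exists_network_of_chains (O := Λ) (T := R * (4 * K + 5) + 2)
    hm (by omega) (networkInput ι) zs _ hc (fun i => by
      rw [hl i]
      have := Nat.mul_le_mul_right (4 * K + 5) (hR i.1 i.1.2)
      omega) p hp (fun s i => if i.1 = s then termCoeff a b i.1.1 i.2.1 else 0)
  refine ⟨Φ, e, hin, by rw [hd], hsz.trans ?_, fun y s => ?_⟩
  · rw [Finset.sum_comm, ← Finset.sum_add_distrib, Fintype.sum_sigma]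
    refine le_trans (Finset.sum_le_sum fun s _ => ?_) (le_of_eq (Finset.sum_coe_sort Λ fun s =>
      (∏ j ∈ s.support, (s j + 1)) * (totalDegree s * (10 * K + 14) + 2)))
    rw [← card_termIndex]
    refine (Finset.sum_le_card_nsmul _ _ (totalDegree s.1 * (10 * K + 14) + 2) fun q _ => ?_).trans
      (le_of_eq (by rw [smul_eq_mul, Finset.card_univ]))
    have : ∑ o : Λ, nz (if s = o then termCoeff a b s.1 q.1 else 0) ≤ 1 := by
      rw [Finset.sum_eq_single s (fun o _ ho => by rw [if_neg ho.symm, nz_zero]) (by simp)]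
      exact nz_le_one _
    dsimp only
    omega
  · rw [hev y _ (fun k => by
        rw [networkInput, dif_pos (k.2.trans_eq hin)]; rfl) s, Fintype.sum_sigma,
      Finset.sum_eq_single s (fun o _ ho => by simp [ho]) (by simp), jacobiTensor_eq_sum_terms,
      ← Finset.sum_sub_distrib]
    simp only [if_true]
    refine (Finset.abs_sum_le_sum_abs _ _).trans ?_
    refine le_trans ?_ (mul_le_mul_of_nonneg_right (sum_abs_termCoeff_le hD s.1) (by positivity))
    rw [Finset.sum_mul]
    refine Finset.sum_le_sum fun q _ => ?_
    rw [← mul_sub, abs_mul]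
    exact mul_le_mul_of_nonneg_left (hpy ⟨s, q⟩ y) (abs_nonneg _)

/-! ## The approximation theorem -/

section Errors

variable {X : Type*} [NormedAddCommGroup X] [InnerProductSpace ℝ X] {a b q : ℝ} {ρ : ℕ → ℝ}
  {v : (ℕ → II) → X} {M : ℝ}

lemma sum_sq_le_of_sqrt_tsum_le {f : (ℕ →₀ ℕ) → ℝ} (hf : Summable fun s => f s ^ 2)
    (hM : √(∑' s, f s ^ 2) ≤ M) (F : Finset (ℕ →₀ ℕ)) : ∑ s ∈ F, f s ^ 2 ≤ M ^ 2 :=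
  (hf.sum_le_tsum F fun _ _ => sq_nonneg _).trans
    ((Real.sqrt_le_left ((Real.sqrt_nonneg _).trans hM)).mp hM)

lemma norm_gpcCoeff_le (h1 : ∀ s, 1 ≤ gpcWeight a b ρ s)
    (hs : Summable fun s => (gpcWeight a b ρ s * ‖gpcCoeff a b v s‖) ^ 2)
    (hM : √(∑' s, (gpcWeight a b ρ s * ‖gpcCoeff a b v s‖) ^ 2) ≤ M) (s : ℕ →₀ ℕ) :
    ‖gpcCoeff a b v s‖ ≤ M := by
  have hM0 : 0 ≤ M := (Real.sqrt_nonneg _).trans hM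
  have h := sum_sq_le_of_sqrt_tsum_le hs hM {s}
  rw [Finset.sum_singleton] at h
  exact (le_mul_of_one_le_left (norm_nonneg _) (h1 s)).trans (le_of_sq_le_sq h hM0)

/-- For `s ∉ Λ(ξ)` one has `1 ≤ ξ^(-1/q) σ_s`; this factor is inserted into the sum of the squared
remaining coefficients. -/
lemma eLpNorm_sub_indexSet_sum_le [CompleteSpace X] (ha : -1 < a) (hb : -1 < b) (hq : 0 < q)
    {ξ : ℝ} (hξ : 0 < ξ) (h1 : ∀ s, 1 ≤ gpcWeight a b ρ s) {Λ : Finset (ℕ →₀ ℕ)}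
    (hΛ : (Λ : Set (ℕ →₀ ℕ)) = indexSet a b q ρ ξ)
    (hv : MemLp v 2 (jacobiProductMeasure a b))
    (hs : Summable fun s => (gpcWeight a b ρ s * ‖gpcCoeff a b v s‖) ^ 2)
    (hM : √(∑' s, (gpcWeight a b ρ s * ‖gpcCoeff a b v s‖) ^ 2) ≤ M) :
    eLpNorm (fun y => v y - ∑ s ∈ Λ, jacobiTensor a b s y • gpcCoeff a b v s) 2
      (jacobiProductMeasure a b) ≤ ENNReal.ofReal (ξ ^ (-(1 / q)) * M) := by
  have hM0 : 0 ≤ M := (Real.sqrt_nonneg _).trans hM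
  have hξ0 : 0 ≤ ξ ^ (-(1 / q)) := Real.rpow_nonneg hξ.le _
  refine eLpNorm_sub_gpc_partialSum_le ha hb hv Λ (mul_nonneg hξ0 hM0) fun F hF => ?_
  calc ∑ s ∈ F, ‖gpcCoeff a b v s‖ ^ 2
      ≤ ∑ s ∈ F, (ξ ^ (-(1 / q))) ^ 2 * (gpcWeight a b ρ s * ‖gpcCoeff a b v s‖) ^ 2 := by
        refine Finset.sum_le_sum fun s hsF => ?_
        have hsΛ : s ∉ indexSet a b q ρ ξ := by
          rw [← hΛ]
          exact fun h => Finset.disjoint_left.mp hF hsF h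
        have hlt : ξ < gpcWeight a b ρ s ^ q := not_le.mp hsΛ
        have hw : 0 ≤ gpcWeight a b ρ s := zero_le_one.trans (h1 s)
        have hle : 1 ≤ ξ ^ (-(1 / q)) * gpcWeight a b ρ s := by
          have h2 := Real.rpow_le_rpow hξ.le hlt.le (one_div_pos.mpr hq).le
          rw [← Real.rpow_mul hw, mul_one_div_cancel hq.ne', Real.rpow_one] at h2
          have h3 : ξ ^ (-(1 / q)) * ξ ^ (1 / q) = 1 := by
            rw [← Real.rpow_add hξ]
            simp
          exact h3.symm.le.trans (mul_le_mul_of_nonneg_left h2 hξ0)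
        rw [← mul_pow, ← mul_assoc]
        gcongr
        exact le_mul_of_one_le_left (norm_nonneg _) hle
    _ = (ξ ^ (-(1 / q))) ^ 2 * ∑ s ∈ F, (gpcWeight a b ρ s * ‖gpcCoeff a b v s‖) ^ 2 :=
        (Finset.mul_sum _ _ _).symm
    _ ≤ (ξ ^ (-(1 / q)) * M) ^ 2 := by
        rw [mul_pow]
        exact mul_le_mul_of_nonneg_left (sum_sq_le_of_sqrt_tsum_le hs hM F) (sq_nonneg _)

/-- The network error is bounded uniformly in `y` and the measure has mass one. The pointwise
majorant makes measurability of `φ` unnecessary. -/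
lemma eLpNorm_sub_perturbed_sum_le (ha : -1 < a) (hb : -1 < b)
    (hv : AEStronglyMeasurable v (jacobiProductMeasure a b)) (Λ : Finset (ℕ →₀ ℕ))
    (φ : Λ → (ℕ → II) → ℝ) {ε : ℝ} (hε : 0 ≤ ε)
    (hφ : ∀ y s, |φ s y - jacobiTensor a b s y| ≤ ε) (hM0 : 0 ≤ M)
    (hM : ∀ s, ‖gpcCoeff a b v s‖ ≤ M) :
    eLpNorm (fun y => v y - ∑ s : Λ, φ s y • gpcCoeff a b v s) 2 (jacobiProductMeasure a b) ≤
      eLpNorm (fun y => v y - ∑ s ∈ Λ, jacobiTensor a b s y • gpcCoeff a b v s) 2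
        (jacobiProductMeasure a b) + ENNReal.ofReal (Λ.card * ε * M) := by
  have := isProbabilityMeasure_jacobiProductMeasure ha hb
  set f : (ℕ → II) → X := fun y => v y - ∑ s ∈ Λ, jacobiTensor a b s y • gpcCoeff a b v s with hf
  have hfm : AEStronglyMeasurable f (jacobiProductMeasure a b) := by
    refine hv.sub (Continuous.aestronglyMeasurable ?_)
    fun_prop
  have hpt : ∀ y, ‖v y - ∑ s : Λ, φ s y • gpcCoeff a b v s‖ ≤ ‖f y‖ + Λ.card * ε * M := by
    intro y
    have e : v y - ∑ s : Λ, φ s y • gpcCoeff a b v s =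
        f y - ∑ s : Λ, (φ s y - jacobiTensor a b s y) • gpcCoeff a b v s := by
      have hfy : f y = v y - ∑ s ∈ Λ, jacobiTensor a b s y • gpcCoeff a b v s := rfl
      simp_rw [sub_smul]
      rw [hfy, Finset.sum_sub_distrib,
        Finset.sum_coe_sort Λ fun s => jacobiTensor a b s y • gpcCoeff a b v s]
      abel
    rw [e]
    refine (norm_sub_le _ _).trans (add_le_add le_rfl ?_)
    refine (norm_sum_le_of_le (f := fun s : Λ => (φ s y - jacobiTensor a b s y) •
      gpcCoeff a b v s) Finset.univ (n := fun _ => ε * M) fun s _ => ?_).trans (le_of_eq ?_)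
    · rw [norm_smul, Real.norm_eq_abs]
      exact mul_le_mul (hφ y s) (hM s) (norm_nonneg _) hε
    · simp [mul_assoc]
  calc eLpNorm (fun y => v y - ∑ s : Λ, φ s y • gpcCoeff a b v s) 2 (jacobiProductMeasure a b)
      ≤ eLpNorm (fun y => ‖f y‖ + Λ.card * ε * M) 2 (jacobiProductMeasure a b) :=
        eLpNorm_mono_real hpt
    _ ≤ eLpNorm (fun y => ‖f y‖) 2 (jacobiProductMeasure a b) +
        eLpNorm (fun _ => Λ.card * ε * M) 2 (jacobiProductMeasure a b) :=
        eLpNorm_add_le hfm.norm aestronglyMeasurable_const (by norm_num)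
    _ = _ := by
        rw [eLpNorm_norm, eLpNorm_const _ (by norm_num) (IsProbabilityMeasure.ne_zero _),
          Real.enorm_eq_ofReal (by positivity)]
        simp

end Errors

/-! ### Choice of parameters: accuracy, size, depth and rate -/

/-- Here `D^N N 4^(-K) ≤ (2D)^N e^(-K)` with `N ≤ L/lam` and `K ≥ θ L`. The first summand of `θ`
cancels `(2D)^N`; the rest leaves `n^(-1-2/q)` when `L = log n`. -/
lemma pow_mul_pow_le_exp {D lam θ q L : ℝ} {N K : ℕ} (hD : 1 ≤ D) (hlam : 0 < lam)
    (hN : lam * N ≤ L) (hK : θ * L ≤ K) (hθ : θ = Real.log (2 * D) / lam + 2 / q + 1) :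
    D ^ N * (N * (1 / 4 : ℝ) ^ K) ≤ Real.exp (-L * (1 + 2 / q)) := by
  have h1 : (N : ℝ) ≤ 2 ^ N := by exact_mod_cast Nat.lt_two_pow_self.le
  have h2 : (1 / 4 : ℝ) ≤ Real.exp (-1) := by
    rw [Real.exp_neg, one_div]
    exact inv_anti₀ (Real.exp_pos _) (by linarith [Real.exp_one_lt_three])
  have hlog : 0 ≤ Real.log (2 * D) := Real.log_nonneg (by linarith)
  have h3 : N * Real.log (2 * D) ≤ L * (Real.log (2 * D) / lam) := by
    have h4 : (N : ℝ) ≤ L / lam := by rw [le_div_iff₀ hlam]; linarith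
    calc N * Real.log (2 * D) ≤ L / lam * Real.log (2 * D) := by gcongr
      _ = _ := by ring
  calc D ^ N * (N * (1 / 4 : ℝ) ^ K) ≤ D ^ N * (2 ^ N * Real.exp (-1) ^ K) := by gcongr
    _ = Real.exp (N * Real.log (2 * D)) * Real.exp (-K) := by
        rw [Real.exp_nat_mul, Real.exp_log (by linarith), mul_pow, ← Real.exp_nat_mul]
        ring_nf
    _ = Real.exp (N * Real.log (2 * D) - K) := by rw [← Real.exp_add]; ring_nf
    _ ≤ _ := by
        refine Real.exp_le_exp.mpr ?_
        have : θ * L = L * (Real.log (2 * D) / lam) + L * (1 + 2 / q) := by rw [hθ]; ring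
        linarith

lemma sum_singleton_zero_networkSize (K : ℕ) : ∑ s ∈ ({0} : Finset (ℕ →₀ ℕ)),
    (∏ j ∈ s.support, (s j + 1)) * (totalDegree s * (10 * K + 14) + 2) = 2 := by
  rw [Finset.sum_singleton]
  simp [totalDegree]

lemma sum_networkSize_le {Λ : Finset (ℕ →₀ ℕ)} {B G : ℝ} {K n : ℕ}
    (hB : ∑ s ∈ Λ, ∏ j ∈ s.support, ((s j : ℝ) + 1) ^ 2 ≤ B) (hG : 10 * (K : ℝ) + 16 ≤ G)
    (hn : B * G ≤ n) :
    ∑ s ∈ Λ, (∏ j ∈ s.support, (s j + 1)) * (totalDegree s * (10 * K + 14) + 2) ≤ n := by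
  have h2 : ∀ s ∈ Λ, (∏ j ∈ s.support, (s j + 1)) * (totalDegree s * (10 * K + 14) + 2) ≤
      (∏ j ∈ s.support, (s j + 1) ^ 2) * (10 * K + 16) := by
    intro s _
    rw [Finset.prod_pow, sq, mul_assoc]
    refine Nat.mul_le_mul_left _ ?_
    refine le_trans ?_ (Nat.mul_le_mul_right _ (totalDegree_add_one_le s))
    nlinarith
  have h3 := Finset.sum_le_sum h2
  rw [← Finset.sum_mul] at h3
  refine h3.trans ?_
  have h4 : (((∑ s ∈ Λ, ∏ j ∈ s.support, (s j + 1) ^ 2) * (10 * K + 16) : ℕ) : ℝ) ≤ n := by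
    push_cast
    refine (mul_le_mul hB hG (by positivity) (le_trans ?_ hB)).trans hn
    positivity
  exact_mod_cast h4

lemma depth_le {lam θ L : ℝ} {R K : ℕ} (hlam : 0 < lam)
    (hlog2 : 1 / 2 ≤ Real.log 2) (hL2 : Real.log 2 ≤ L) (hR : (R : ℝ) ≤ L / lam)
    (hK : (K : ℝ) ≤ θ * L + 1) :
    ((R * (4 * K + 5) + 3 : ℕ) : ℝ) ≤ (12 + (4 * θ + 18) / lam) * L ^ 2 := by
  have hL0 : 0 < L := by linarith
  have h1 : (R : ℝ) * (4 * K + 5) ≤ (L / lam) * ((4 * θ + 18) * L) :=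
    mul_le_mul hR (by linarith) (by positivity) (by positivity)
  -- Since `L ≥ 1/2`, additive constants become multiples of `L` or `L^2`: `3 ≤ 12 L^2`, and above
  -- `9 ≤ 18 L`.
  have h2 : (3 : ℝ) ≤ 12 * L ^ 2 := by nlinarith
  push_cast
  calc (R : ℝ) * (4 * K + 5) + 3 ≤ (L / lam) * ((4 * θ + 18) * L) + 12 * L ^ 2 :=
        add_le_add h1 h2
    _ = _ := by ring

/-- The factor `n^(-1)` in the network accuracy pays for the `N ≤ A n` indices. The factor
`n^(-2/q)` is at most `x^(-1/q)` because `x = n/L ≤ 2n ≤ n^2`. The harmless `Cd` lets one constant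
serve both depth and error. -/
lemma error_constant_le {A c q ξ x L n N Cd M : ℝ} (hq : 0 < q) (hA : 0 ≤ A) (hc : 0 < c)
    (hCd : 0 ≤ Cd) (hM : 0 ≤ M) (hn : 2 ≤ n) (hL2 : Real.log 2 ≤ L) (hlog2 : 1 / 2 ≤ Real.log 2)
    (hL : L = Real.log n) (hx1 : 1 ≤ x) (hx : x = n / L) (hξn : ξ ≤ n) (hξ : c * x ≤ ξ)
    (hN : N ≤ A * ξ) :
    ξ ^ (-(1 / q)) * M + N * Real.exp (-L * (1 + 2 / q)) * M ≤
      (A + c ^ (-(1 / q)) + Cd) * M * x ^ (-(1 / q)) := by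
  have hx0 : 0 < x := by linarith
  have hL0 : 0 < L := by linarith
  have h1 : ξ ^ (-(1 / q)) ≤ c ^ (-(1 / q)) * x ^ (-(1 / q)) := by
    rw [← Real.mul_rpow hc.le hx0.le]
    exact Real.rpow_le_rpow_of_nonpos (by positivity) hξ
      (by have := one_div_pos.mpr hq; linarith)
  have h2 : Real.exp (-(L * (2 / q))) ≤ x ^ (-(1 / q)) := by
    rw [Real.rpow_def_of_pos hx0]
    refine Real.exp_le_exp.mpr ?_
    have hxn : Real.log x ≤ 2 * L := by
      have : x ≤ n ^ 2 := by
        rw [hx, div_le_iff₀ hL0]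
        nlinarith
      have h := Real.log_le_log hx0 this
      rw [Real.log_pow, ← hL] at h
      exact_mod_cast h
    have hq' := one_div_pos.mpr hq
    have : Real.log x * (1 / q) ≤ 2 * L * (1 / q) := by gcongr
    calc -(L * (2 / q)) = -(2 * L * (1 / q)) := by ring
      _ ≤ -(Real.log x * (1 / q)) := neg_le_neg this
      _ = _ := by ring
  have h3 : N * Real.exp (-L * (1 + 2 / q)) ≤ A * x ^ (-(1 / q)) := by
    have he : Real.exp (-L * (1 + 2 / q)) = Real.exp (-L) * Real.exp (-(L * (2 / q))) := by
      rw [← Real.exp_add]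
      ring_nf
    have hLe : n * Real.exp (-L) = 1 := by
      rw [Real.exp_neg, hL, Real.exp_log (by linarith)]
      exact mul_inv_cancel₀ (by linarith)
    calc N * Real.exp (-L * (1 + 2 / q)) ≤ (A * n) * Real.exp (-L * (1 + 2 / q)) :=
          mul_le_mul_of_nonneg_right (hN.trans (mul_le_mul_of_nonneg_left hξn hA))
            (Real.exp_pos _).le
      _ = A * (n * Real.exp (-L)) * Real.exp (-(L * (2 / q))) := by rw [he]; ring
      _ = A * Real.exp (-(L * (2 / q))) := by rw [hLe, mul_one]
      _ ≤ _ := mul_le_mul_of_nonneg_left h2 hA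
  have hxq : 0 ≤ x ^ (-(1 / q)) := Real.rpow_nonneg hx0.le _
  calc ξ ^ (-(1 / q)) * M + N * Real.exp (-L * (1 + 2 / q)) * M
      ≤ c ^ (-(1 / q)) * x ^ (-(1 / q)) * M + A * x ^ (-(1 / q)) * M := by gcongr
    _ = (A + c ^ (-(1 / q)) + 0) * M * x ^ (-(1 / q)) := by ring
    _ ≤ _ := by gcongr

end JacobiReLU

end

set_option maxHeartbeats 400000 in
open JacobiReLU in
theorem mainTheorem4 (a b q : ℝ) (ha : -1 < a) (hb : -1 < b) (hq : 0 < q)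
    (δ ρ : ℕ → ℝ) (hδ : ∀ j, 1 < δ j) (hδq : Summable fun j => (δ j)⁻¹ ^ q)
    (hρ : ∀ j, 0 < ρ j)
    (hρδ : ∀ k j : ℕ, 1 ≤ k → jacobiConst a b k * (ρ j ^ k)⁻¹ ≤ (δ j ^ k)⁻¹) :
    ∃ K > (0 : ℝ), ∃ C > (0 : ℝ), ∃ C₁ > (0 : ℝ), ∃ C₂ > (0 : ℝ), ∀ n : ℕ, 1 < n →
      ∃ ξ : ℝ, 1 < ξ ∧ C₁ * (n / Real.log n) ≤ ξ ∧ ξ ≤ C₂ * (n / Real.log n) ∧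
      ∃ (Λ : Finset (ℕ →₀ ℕ)) (Φ : ReLUNetwork) (e : Λ ≃ Fin Φ.outputDim)
        (ι : Fin Φ.inputDim ↪ ℕ),
        (Λ : Set (ℕ →₀ ℕ)) = indexSet a b q ρ ξ ∧
        (Monotone ρ → ∀ k, ι k = k) ∧
        3 ≤ Φ.depth ∧
        Φ.inputDim = ⌊K * (n / Real.log n)⌋₊ ∧
        Φ.outputDim ≤ ⌊K * (n / Real.log n)⌋₊ ∧
        Φ.size ≤ n ∧
        (Φ.depth : ℝ) ≤ C * Real.log n ^ 2 ∧
        ∀ (X : Type*) [NormedAddCommGroup X] [InnerProductSpace ℝ X] [CompleteSpace X]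
          (M : ℝ) (v : (ℕ → II) → X),
          MemLp v 2 (jacobiProductMeasure a b) →
          Summable (fun s => (gpcWeight a b ρ s * ‖gpcCoeff a b v s‖) ^ 2) →
          √(∑' s, (gpcWeight a b ρ s * ‖gpcCoeff a b v s‖) ^ 2) ≤ M →
          eLpNorm (fun y => v y - ∑ s : Λ,
              Φ.eval (fun k => (y (ι k) : ℝ)) (e s) • gpcCoeff a b v s) 2
            (jacobiProductMeasure a b) ≤
            ENNReal.ofReal (C * M * (n / Real.log n : ℝ) ^ (-(1 / q))) := by
  have hr := inv_rpow_bounds hq hδ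
  have hr0 : 0 ≤ ∑' j, (δ j)⁻¹ ^ q := tsum_nonneg fun j => (hr j).1.le
  obtain ⟨A₀, hA₀, hA₀F⟩ := exists_sum_multiIndex_le (fun j => (hr j).1.le) (fun j => (hr j).2) hδq
  obtain ⟨t, ht0, ht1, ht⟩ := exists_uniform_bound_lt_one (fun j => (hr j).2) hδq
  obtain ⟨D, hD1, hD⟩ := exists_sum_abs_bernsteinCoeff_le ha hb (θ := ρ 0 / δ 0) (by
    intro k hk
    have h := hρδ k 0 hk
    have h1 := pow_pos (hρ 0) k
    rw [← div_eq_mul_inv, div_le_iff₀ h1] at h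
    rw [div_pow, div_eq_inv_mul]
    exact h)
  -- One constant dominating both the generating function and `∑ δ_j^(-q)` bounds the cardinality of
  -- `Λ(ξ)` as well as the number of coordinates.
  set A := A₀ + ∑' j, (δ j)⁻¹ ^ q with hAdef
  have hA : 0 < A := by linarith
  have hAF : ∀ F : Finset (ℕ →₀ ℕ), ∑ s ∈ F, ∏ j ∈ s.support,
      (((s j : ℝ) + 1) ^ 2 * ((δ j)⁻¹ ^ q) ^ s j) ≤ A := fun F => (hA₀F F).trans (by linarith)
  set lam := -Real.log t with hlamdef
  have hlam : 0 < lam := by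
    have := Real.log_neg ht0 ht1
    linarith
  set θ := Real.log (2 * D) / lam + 2 / q + 1 with hθdef
  have hθ : 0 < θ := by
    have : 0 ≤ Real.log (2 * D) := Real.log_nonneg (by linarith)
    positivity
  have hlog2 : 1 / 2 < Real.log 2 := by linarith [Real.log_two_gt_d9]
  -- The first bound gives `c x ≤ L x = n`, the second makes the size at most `n`.
  set c := min (Real.log 2) (1 / (A * (10 * θ + 52))) with hcdef
  have hc : 0 < c := lt_min (by linarith) (by positivity)
  have hc1 : c ≤ Real.log 2 := min_le_left _ _
  have hc2 : c * (A * (10 * θ + 52)) ≤ 1 := by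
    rw [← le_div_iff₀ (by positivity)]
    exact min_le_right _ _
  -- For small `n` the value `c x` may fail to exceed one. This floor lies in `(1, 2)` and satisfies
  -- `ξ₀ t < 1`, so `Λ(ξ₀) = {0}` and the network has size at most two.
  set ξ₀ := 2 / (1 + t) with hξ₀def
  have hξ₀1 : 1 < ξ₀ := by rw [hξ₀def, lt_div_iff₀ (by linarith)]; linarith
  have hξ₀2 : ξ₀ < 2 := by rw [hξ₀def, div_lt_iff₀ (by linarith)]; linarith
  have hξ₀t : ξ₀ * t < 1 := by
    rw [hξ₀def, div_mul_eq_mul_div, div_lt_one (by linarith)]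
    linarith
  set Cd := 12 + (4 * θ + 18) / lam with hCd
  have hCd0 : 0 < Cd := by positivity
  clear_value A lam θ c ξ₀ Cd
  have hcq : 0 < c ^ (-(1 / q)) := Real.rpow_pos_of_pos hc _
  -- The summand `1` in `K` guarantees `m ≥ 1`, because `x ≥ 1`.
  refine ⟨A * (ξ₀ + c) + 1, by positivity, A + c ^ (-(1 / q)) + Cd, by positivity, c, hc, ξ₀ + c,
    by linarith, fun n hn => ?_⟩
  have hn2 : (2 : ℝ) ≤ n := by exact_mod_cast hn
  set L := Real.log n with hLdef
  have hL2 : Real.log 2 ≤ L := Real.log_le_log (by norm_num) hn2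
  have hL0 : 0 < L := by linarith
  have hLn : L ≤ n := by
    have := Real.log_le_sub_one_of_pos (show (0 : ℝ) < n by linarith)
    linarith
  set x := (n : ℝ) / L with hxdef
  have hx1 : 1 ≤ x := (one_le_div hL0).mpr hLn
  have hxL : x * L = n := div_mul_cancel₀ _ hL0.ne'
  clear_value L x
  have hcx : c * x ≤ n := by
    rw [← hxL, mul_comm x L]
    exact mul_le_mul_of_nonneg_right (hc1.trans hL2) (by linarith)
  set ξ := max ξ₀ (c * x) with hξdef
  have hξ1 : 1 < ξ := lt_max_of_lt_left hξ₀1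
  have hξc : c * x ≤ ξ := le_max_right _ _
  have hξn : ξ ≤ n := max_le (by linarith) hcx
  have hξx : ξ ≤ (ξ₀ + c) * x := by
    refine max_le ?_ ?_
    · nlinarith
    · nlinarith
  clear_value ξ
  have hξ0 : 0 ≤ ξ := by linarith
  have hfin := finite_indexSet ha hb hq hδ hρ hρδ hAF hξ0
  obtain ⟨Λ, hΛ⟩ : ∃ Λ : Finset (ℕ →₀ ℕ), (Λ : Set (ℕ →₀ ℕ)) = indexSet a b q ρ ξ :=
    ⟨hfin.toFinset, hfin.coe_toFinset⟩
  have hΛmem : ∀ s, s ∈ Λ ↔ s ∈ indexSet a b q ρ ξ := fun s => by rw [← hΛ, Finset.mem_coe]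
  have hΛ0 : Λ.Nonempty := ⟨0, (hΛmem 0).mpr (zero_mem_indexSet hξ1.le)⟩
  have hcard : (Λ.card : ℝ) ≤ A * ξ := card_le_of_subset_indexSet ha hb hq hδ hρ hρδ hAF hξ0 hΛ.le
  set m := ⌊(A * (ξ₀ + c) + 1) * x⌋₊ with hmdef
  have hAξ : A * ξ + 1 ≤ (A * (ξ₀ + c) + 1) * x := by nlinarith
  have hm : 0 < m := Nat.floor_pos.mpr (by nlinarith)
  have hcardm : Λ.card ≤ m := Nat.le_floor (by linarith)
  obtain ⟨ι, hιmono, hι⟩ := exists_coordinates ha hb hq hδ hδq hρ hρδ hξ0 (m := m) (by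
    have h1 := Nat.lt_floor_add_one ((A * (ξ₀ + c) + 1) * x)
    have h2 : (∑' j, (δ j)⁻¹ ^ q) * ξ ≤ A * ξ := mul_le_mul_of_nonneg_right (by linarith) hξ0
    linarith)
  have hdeg : ∀ s ∈ Λ, lam * totalDegree s ≤ L := by
    intro s hs
    have h1 := one_le_mul_pow_totalDegree ha hb hq hδ hρ hρδ ht hξ0 ((hΛmem s).mp hs)
    have h2 : 1 ≤ n * t ^ totalDegree s :=
      h1.trans (mul_le_mul_of_nonneg_right hξn (pow_nonneg ht0.le _))
    have h3 := Real.log_nonneg h2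
    rw [Real.log_mul (by linarith) (pow_ne_zero _ ht0.ne'), Real.log_pow] at h3
    rw [hlamdef, neg_mul, mul_comm]
    linarith
  set K := ⌈θ * L⌉₊ with hKdef
  have hK1 : θ * L ≤ K := Nat.le_ceil _
  have hK2 : (K : ℝ) ≤ θ * L + 1 := (Nat.ceil_lt_add_one (by positivity)).le
  have hR1 : (⌊L / lam⌋₊ : ℝ) ≤ L / lam := Nat.floor_le (by positivity)
  set R := ⌊L / lam⌋₊ with hRdef
  have hR : ∀ s ∈ Λ, totalDegree s ≤ R := fun s hs =>
    Nat.le_floor (by rw [le_div_iff₀ hlam, mul_comm]; exact hdeg s hs)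
  clear_value m K R
  obtain ⟨Φ, e, hin, hdepth, hsize, herr⟩ := exists_network_jacobiTensor hD hm ι Λ hΛ0
    (fun s hs => hι s ((hΛmem s).mp hs)) K R hR
  refine ⟨ξ, hξ1, hξc, hξx, Λ, Φ, e, (finCongr hin).toEmbedding.trans ι, hΛ, ?_, ?_,
    hin, ?_, ?_, ?_, ?_⟩
  · intro hmono k
    exact hιmono hmono _
  · omega
  · have := Fintype.card_congr e
    rw [Fintype.card_coe, Fintype.card_fin] at this
    omega
  · refine hsize.trans ?_
    rcases le_total (c * x) ξ₀ with hle | hle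
    · have hΛs : Λ = {0} := by
        refine Finset.eq_singleton_iff_unique_mem.mpr
          ⟨(hΛmem 0).mpr (zero_mem_indexSet hξ1.le), fun s hs => ?_⟩
        by_contra hs0
        have h1 := one_le_mul_pow_totalDegree ha hb hq hδ hρ hρδ ht hξ0 ((hΛmem s).mp hs)
        rw [hξdef, max_eq_left hle] at h1
        have h2 : t ^ totalDegree s ≤ t ^ 1 :=
          pow_le_pow_of_le_one ht0.le ht1.le (totalDegree_pos hs0)
        rw [pow_one] at h2
        nlinarith
      rw [hΛs, sum_singleton_zero_networkSize]
      exact hn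
    · have hξ' : ξ = c * x := hξdef.trans (max_eq_right hle)
      -- From `K ≤ θ L + 1` one gets `10 K + 16 ≤ 10 θ L + 26`, and `26 ≤ 52 L`; this is the
      -- constant built into `c`.
      refine sum_networkSize_le (sum_prod_sq_le ha hb hq hδ hρ hρδ hAF hξ0 hΛ.le)
        (G := (10 * θ + 52) * L) ?_ ?_
      · nlinarith only [hK2, hL2, hlog2]
      · calc A * ξ * ((10 * θ + 52) * L) = (c * (A * (10 * θ + 52))) * (x * L) := by
              rw [hξ']; ring
          _ ≤ 1 * (x * L) := mul_le_mul_of_nonneg_right hc2 (by positivity)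
          _ = n := by rw [one_mul, hxL]
  · rw [hdepth]
    exact (depth_le hlam hlog2.le hL2 hR1 hK2).trans
      (mul_le_mul_of_nonneg_right (by rw [← hCd]; linarith only [hA, hcq]) (sq_nonneg L))
  · intro X _ _ _ M v hv hs hM
    have hM0 : 0 ≤ M := (Real.sqrt_nonneg _).trans hM
    have hw := one_le_gpcWeight ha hb hδ hρ hρδ
    set ε := Real.exp (-L * (1 + 2 / q)) with hεdef
    have hφ : ∀ y s, |Φ.eval (fun k => (y (((finCongr hin).toEmbedding.trans ι) k) : ℝ)) (e s) -
        jacobiTensor a b s y| ≤ ε := fun y s =>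
      (herr y s).trans (pow_mul_pow_le_exp hD1 hlam (hdeg s s.2) hK1 hθdef)
    refine (eLpNorm_sub_perturbed_sum_le ha hb hv.1 Λ
      (fun s y => Φ.eval (fun k => (y (((finCongr hin).toEmbedding.trans ι) k) : ℝ)) (e s))
      (Real.exp_pos _).le hφ hM0 (norm_gpcCoeff_le hw hs hM)).trans ?_
    refine (add_le_add_left (eLpNorm_sub_indexSet_sum_le ha hb hq (by linarith) hw hΛ hv hs hM)
      _).trans ?_
    rw [← ENNReal.ofReal_add (by positivity) (by positivity)]
    refine ENNReal.ofReal_le_ofReal ?_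
    exact error_constant_le hq hA.le hc hCd0.le hM0 hn2 hL2 hlog2.le hLdef hx1 hxdef hξn
      hξc hcard
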